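/- Let $\mathsf{RCA}_0^\omega=\mathsf{E\text{-}PRA}^\omega+\mathsf{QF\text{-}AC}^{1,0}$ be Kohlenbach's base theory of higher-order reverse mathematics: classical arithmetic in all finite types with the combinators, the recursor $R_0$ for primitive recursion of type $0$, quantifier-free induction, the axiom of extensionality, and the axiom of choice $\forall f^1\exists x^0A(f,x)\to\exists F^2\forall f^1A(f,F(f))$ for quantifier-free $A$. Here $0$ is the type of natural numbers, $1=0\to0$ and $2=1\to0$. Sets of numbers are given by binary characteristic functions of type $1$, and a function $f:[\mathbb N]^2\to\mathbb N$ is given by an object of type $1$ via the bijection $\{k<l\}\mapsto l(l-1)/2+k$ of $[\mathbb N]^2$ with $\mathbb N$. Write * $\mathsf{MU}(\mu^2)$ for $(\forall f^1)\big[(\exists n)f(n)=0\to f(\mu(f))=0\big]$, and $(\mu^2)$ for $(\exists\mu^2)\,\mathsf{MU}(\mu)$; * $\mathsf{UTS}(\Psi^{1\to1})$ for: for all $f:[\mathbb N]^2\to\mathbb N$, the set $\Psi(f)$ is infinite and $(\exists n)\,n\notin f([\Psi(f)]^2)$; and $\mathsf{UTS}(2)$ for $(\exists\Psi^{1\to1})\,\mathsf{UTS}(\Psi)$;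 * $\mathsf{UTS}(\Psi^{1\to 1},N^2)$ for: for all $f:[\mathbb N]^2\to\mathbb N$, the set $\Psi(f)$ is infinite and $N(f)\notin f([\Psi(f)]^2)$; * $\mathsf{Ext}(\Xi,\Psi,N)$ for: $\Xi^{1\to1\to0\to0}$ is an extensionality functional for $f\mapsto(\Psi(f),N(f))$, that is, for all $f^1,g^1,k^0$, if $f$ and $g$ agree on all $i<\Xi(f,g,k)$, then $\Psi(f)$ and $\Psi(g)$ agree on all $i<k$ and $N(f)=N(g)$. **Theorem.** $\mathsf{RCA}_0^\omega$ proves $(\mu^2)\leftrightarrow\mathsf{UTS}(2)$, and this equivalence is explicit, as follows. 1. There are closed terms $s,n$ of the language such that $\mathsf{RCA}_0^\omega$ proves $(\forall\mu^2)\big[\mathsf{MU}(\mu)\to\mathsf{UTS}(s(\mu))\big]$ and $(\forall\mu^2)\big[\mathsf{MU}(\mu)\to\mathsf{UTS}(s(\mu),n(\mu))\big]$. 2. There is a closed term $u$ of the language such that $\mathsf{RCA}_0^\omega$ proves $(\forall\Psi,N,\Xi)\big[\mathsf{UTS}(\Psi,N)\wedge\mathsf{Ext}(\Xi,\Psi,N)\to\mathsf{MU}(u(\Psi,N,\Xi))\big]$.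 Moreover, $\mathsf{RCA}_0^\omega$ proves $(\forall\Psi)\big[\mathsf{UTS}(\Psi)\to(\exists N,\Xi)(\mathsf{UTS}(\Psi,N)\wedge\mathsf{Ext}(\Xi,\Psi,N))\big]$. -/

import Mathlib

/-!
The theory `RCA₀^ω = E-PRA^ω + QF-AC^{1,0}` of higher-order arithmetic: its finite types, its terms,
its formulas, its axioms and provability in it; then the formulas for Feferman's search operator,
the uniform thin set theorem for pairs, and extensionality functionals.
-/

namespace RCAomega

/-! ### Finite types, variables, terms -/

/-- The finite types: the type `0` of natural numbers, and function types. -/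
inductive Ty : Type
  | nat : Ty
  | arrow : Ty → Ty → Ty
  deriving DecidableEq

infixr:60 " ⇢ " => Ty.arrow

/-- The type `1 = 0 → 0`. -/
abbrev Ty.one : Ty := Ty.nat ⇢ Ty.nat

/-- The type `2 = 1 → 0`. -/
abbrev Ty.two : Ty := Ty.one ⇢ Ty.nat

/-- A context lists the types of the variables that may occur free. -/
abbrev Ctx : Type := List Ty

/-- `Var Γ σ`: a (de Bruijn) variable of type `σ` in the context `Γ`. -/
inductive Var : Ctx → Ty → Type
  | z {Γ : Ctx} {σ : Ty} : Var (σ :: Γ) σ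
  | s {Γ : Ctx} {σ τ : Ty} : Var Γ σ → Var (τ :: Γ) σ

/-- The terms of the language: variables, application, zero, successor, the combinators
`Π` (here `K`) and `Σ` (here `S`) in all finite types, and the recursor `R₀` of type-`0`
(Kleene) primitive recursion. -/
inductive Term (Γ : Ctx) : Ty → Type
  | var {σ : Ty} : Var Γ σ → Term Γ σ
  | app {σ τ : Ty} : Term Γ (σ ⇢ τ) → Term Γ σ → Term Γ τ
  | zero : Term Γ Ty.nat
  | succ : Term Γ Ty.one
  | K (σ τ : Ty) : Term Γ (σ ⇢ τ ⇢ σ)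
  | S (ρ σ τ : Ty) : Term Γ ((ρ ⇢ σ ⇢ τ) ⇢ (ρ ⇢ σ) ⇢ ρ ⇢ τ)
  | R : Term Γ (Ty.nat ⇢ (Ty.nat ⇢ Ty.nat ⇢ Ty.nat) ⇢ Ty.nat ⇢ Ty.nat)

infixl:80 " ⬝ " => Term.app

/-- Renamings of variables. -/
abbrev Ren (Γ Δ : Ctx) : Type := ∀ σ : Ty, Var Γ σ → Var Δ σ

/-- Simultaneous substitutions of terms for variables. -/
abbrev Sub (Γ Δ : Ctx) : Type := ∀ σ : Ty, Var Γ σ → Term Δ σ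

/-- A renaming, extended below a binder. -/
def Ren.lift {Γ Δ : Ctx} (r : Ren Γ Δ) (τ : Ty) : Ren (τ :: Γ) (τ :: Δ)
  | _, Var.z => Var.z
  | _, Var.s x => Var.s (r _ x)

def Term.rename {Γ Δ : Ctx} (r : Ren Γ Δ) : {σ : Ty} → Term Γ σ → Term Δ σ
  | _, .var x => .var (r _ x)
  | _, .app a b => .app (a.rename r) (b.rename r)
  | _, .zero => .zero
  | _, .succ => .succ
  | _, .K σ τ => .K σ τ
  | _, .S ρ σ τ => .S ρ σ τ
  | _, .R => .R

def Term.subst {Γ Δ : Ctx} (θ : Sub Γ Δ) : {σ : Ty} → Term Γ σ → Term Δ σ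
  | _, .var x => θ _ x
  | _, .app a b => .app (a.subst θ) (b.subst θ)
  | _, .zero => .zero
  | _, .succ => .succ
  | _, .K σ τ => .K σ τ
  | _, .S ρ σ τ => .S ρ σ τ
  | _, .R => .R

/-- Weakening of a term by one new variable. -/
def Term.wk {Γ : Ctx} {σ : Ty} (τ : Ty) (t : Term Γ σ) : Term (τ :: Γ) σ :=
  t.rename (fun _ x => Var.s x)

/-- The renaming out of the empty context. -/
def Ren.ofEmpty {Γ : Ctx} : Ren [] Γ := fun _ x => nomatch x

/-- A closed term, viewed as a term in an arbitrary context. -/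
def Term.ofClosed {Γ : Ctx} {σ : Ty} (t : Term [] σ) : Term Γ σ :=
  t.rename Ren.ofEmpty

/-- A substitution, extended below a binder. -/
def Sub.lift {Γ Δ : Ctx} (θ : Sub Γ Δ) (τ : Ty) : Sub (τ :: Γ) (τ :: Δ)
  | _, Var.z => .var Var.z
  | _, Var.s x => (θ _ x).wk τ

/-- The substitution that replaces the most recent variable by `t`. -/
def Sub.single {Γ : Ctx} {τ : Ty} (t : Term Γ τ) : Sub (τ :: Γ) Γ
  | _, Var.z => t
  | _, Var.s x => .var x

/-! ### Formulas -/

/-- The formulas: equations between terms of type `0`, falsity, implication, and universal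
quantification over each finite type. As the logic is classical, the other connectives are
abbreviations. -/
inductive Formula : Ctx → Type
  | eq {Γ : Ctx} : Term Γ Ty.nat → Term Γ Ty.nat → Formula Γ
  | bot {Γ : Ctx} : Formula Γ
  | imp {Γ : Ctx} : Formula Γ → Formula Γ → Formula Γ
  | all {Γ : Ctx} (σ : Ty) : Formula (σ :: Γ) → Formula Γ

namespace Formula

infixr:40 " ⇾ " => Formula.imp
infix:55 " ≐ " => Formula.eq

def neg {Γ : Ctx} (φ : Formula Γ) : Formula Γ := φ ⇾ bot
def and {Γ : Ctx} (φ ψ : Formula Γ) : Formula Γ := neg (φ ⇾ neg ψ)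
def or {Γ : Ctx} (φ ψ : Formula Γ) : Formula Γ := neg φ ⇾ ψ
def iff {Γ : Ctx} (φ ψ : Formula Γ) : Formula Γ := and (φ ⇾ ψ) (ψ ⇾ φ)
def ex {Γ : Ctx} (σ : Ty) (φ : Formula (σ :: Γ)) : Formula Γ := neg (all σ (neg φ))

infixr:50 " ⋀ " => Formula.and
infixr:45 " ⋁ " => Formula.or

def rename : {Γ Δ : Ctx} → Ren Γ Δ → Formula Γ → Formula Δ
  | _, _, r, .eq a b => .eq (a.rename r) (b.rename r)
  | _, _, _, .bot => .bot
  | _, _, r, .imp φ ψ => .imp (φ.rename r) (ψ.rename r)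
  | _, _, r, .all σ φ => .all σ (φ.rename (r.lift σ))

def subst : {Γ Δ : Ctx} → Sub Γ Δ → Formula Γ → Formula Δ
  | _, _, θ, .eq a b => .eq (a.subst θ) (b.subst θ)
  | _, _, _, .bot => .bot
  | _, _, θ, .imp φ ψ => .imp (φ.subst θ) (ψ.subst θ)
  | _, _, θ, .all σ φ => .all σ (φ.subst (θ.lift σ))

def wk {Γ : Ctx} (τ : Ty) (φ : Formula Γ) : Formula (τ :: Γ) :=
  φ.rename (fun _ x => Var.s x)

/-- `φ.inst t`: the formula `φ` with `t` for its most recent variable. -/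
def inst {Γ : Ctx} {τ : Ty} (φ : Formula (τ :: Γ)) (t : Term Γ τ) : Formula Γ :=
  φ.subst (Sub.single t)

/-- Quantifier-free formulas (with parameters of arbitrary types). -/
def QF : {Γ : Ctx} → Formula Γ → Prop
  | _, .eq _ _ => True
  | _, .bot => True
  | _, .imp φ ψ => φ.QF ∧ ψ.QF
  | _, .all _ _ => False

/-- Equality in the type `τ = τ₁ → ⋯ → τₖ → 0`: the formula
`∀ z₁ ⋯ zₖ, a z₁ ⋯ zₖ =₀ b z₁ ⋯ zₖ`. -/
def eqT : {Γ : Ctx} → (τ : Ty) → Term Γ τ → Term Γ τ → Formula Γ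
  | _, .nat, a, b => a ≐ b
  | _, .arrow σ τ, a, b => all σ (eqT τ (a.wk σ ⬝ .var .z) (b.wk σ ⬝ .var .z))

end Formula

open Formula

/-! ### Axioms and provability -/

/-- The substitution that turns `A(x⁰, f¹)` into `A(F f, f)`, where `f` is the most recent
and `F²` the next variable. -/
def Sub.choice {Γ : Ctx} : Sub (Ty.nat :: Ty.one :: Γ) (Ty.one :: Ty.two :: Γ)
  | _, Var.z => .var (.s .z) ⬝ .var .z
  | _, Var.s Var.z => .var .z
  | _, Var.s (Var.s x) => .var (.s (.s x))

/-- The substitution that turns `A(x)` into `A(x + 1)`. -/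
def Sub.next {Γ : Ctx} : Sub (Ty.nat :: Γ) (Ty.nat :: Γ)
  | _, Var.z => .succ ⬝ .var .z
  | _, Var.s x => .var (.s x)

/-- The non-logical axioms of `RCA₀^ω`. -/
inductive Axiom : {Γ : Ctx} → Formula Γ → Prop
  | succ_ne_zero {Γ : Ctx} (a : Term Γ Ty.nat) : Axiom (neg (.succ ⬝ a ≐ .zero))
  | succ_inj {Γ : Ctx} (a b : Term Γ Ty.nat) : Axiom (.succ ⬝ a ≐ .succ ⬝ b ⇾ a ≐ b)
  | K {Γ : Ctx} {σ τ : Ty} (a : Term Γ σ) (b : Term Γ τ) : Axiom (eqT σ (.K σ τ ⬝ a ⬝ b) a)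
  | S {Γ : Ctx} {ρ σ τ : Ty} (a : Term Γ (ρ ⇢ σ ⇢ τ)) (b : Term Γ (ρ ⇢ σ)) (c : Term Γ ρ) :
      Axiom (eqT τ (.S ρ σ τ ⬝ a ⬝ b ⬝ c) (a ⬝ c ⬝ (b ⬝ c)))
  | R_zero {Γ : Ctx} (a : Term Γ Ty.nat) (b : Term Γ (Ty.nat ⇢ Ty.nat ⇢ Ty.nat)) :
      Axiom (.R ⬝ a ⬝ b ⬝ .zero ≐ a)
  | R_succ {Γ : Ctx} (a : Term Γ Ty.nat) (b : Term Γ (Ty.nat ⇢ Ty.nat ⇢ Ty.nat))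
      (c : Term Γ Ty.nat) :
      Axiom (.R ⬝ a ⬝ b ⬝ (.succ ⬝ c) ≐ b ⬝ (.R ⬝ a ⬝ b ⬝ c) ⬝ c)
  /-- The axiom of extensionality. -/
  | ext {Γ : Ctx} {σ τ : Ty} (f : Term Γ (σ ⇢ τ)) (a b : Term Γ σ) :
      Axiom (eqT σ a b ⇾ eqT τ (f ⬝ a) (f ⬝ b))
  /-- Induction for quantifier-free formulas. -/
  | ind {Γ : Ctx} (φ : Formula (Ty.nat :: Γ)) (hφ : φ.QF) :
      Axiom (φ.inst .zero ⋀ all Ty.nat (φ ⇾ φ.subst Sub.next) ⇾ all Ty.nat φ)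
  /-- `QF-AC^{1,0}`: the axiom of choice `∀ f¹ ∃ x⁰ A(f, x) → ∃ F² ∀ f¹ A(f, F f)` for
  quantifier-free `A`. -/
  | qfac {Γ : Ctx} (φ : Formula (Ty.nat :: Ty.one :: Γ)) (hφ : φ.QF) :
      Axiom (all Ty.one (ex Ty.nat φ) ⇾ ex Ty.two (all Ty.one (φ.subst Sub.choice)))

/-- `Derives H φ`: the formula `φ` is derivable in `RCA₀^ω` from the hypotheses `H`, in natural
deduction for many-sorted classical logic with equality. -/
inductive Derives : {Γ : Ctx} → List (Formula Γ) → Formula Γ → Prop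
  | ax {Γ : Ctx} {H : List (Formula Γ)} {φ : Formula Γ} : Axiom φ → Derives H φ
  | hyp {Γ : Ctx} {H : List (Formula Γ)} {φ : Formula Γ} : φ ∈ H → Derives H φ
  | impI {Γ : Ctx} {H : List (Formula Γ)} {φ ψ : Formula Γ} :
      Derives (φ :: H) ψ → Derives H (φ ⇾ ψ)
  | impE {Γ : Ctx} {H : List (Formula Γ)} {φ ψ : Formula Γ} :
      Derives H (φ ⇾ ψ) → Derives H φ → Derives H ψ
  /-- Proof by contradiction. -/
  | raa {Γ : Ctx} {H : List (Formula Γ)} {φ : Formula Γ} :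
      Derives (neg φ :: H) bot → Derives H φ
  | allI {Γ : Ctx} {H : List (Formula Γ)} {σ : Ty} {φ : Formula (σ :: Γ)} :
      Derives (H.map (Formula.wk σ)) φ → Derives H (all σ φ)
  | allE {Γ : Ctx} {H : List (Formula Γ)} {σ : Ty} {φ : Formula (σ :: Γ)} (t : Term Γ σ) :
      Derives H (all σ φ) → Derives H (φ.inst t)
  | eqI {Γ : Ctx} {H : List (Formula Γ)} (a : Term Γ Ty.nat) : Derives H (a ≐ a)
  | eqE {Γ : Ctx} {H : List (Formula Γ)} {a b : Term Γ Ty.nat} (φ : Formula (Ty.nat :: Γ)) :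
      Derives H (a ≐ b) → Derives H (φ.inst a) → Derives H (φ.inst b)

/-- `RCA₀^ω` proves the sentence `φ`. -/
def Provable (φ : Formula []) : Prop := Derives [] φ

/-! ### Arithmetic in the language -/

section Arithmetic

variable {Γ : Ctx}

/-- The most recent variable, the one before it, and the one before that. -/
abbrev v0 {σ : Ty} : Term (σ :: Γ) σ := .var .z
abbrev v1 {σ τ : Ty} : Term (τ :: σ :: Γ) σ := .var (.s .z)
abbrev v2 {σ τ ρ : Ty} : Term (ρ :: τ :: σ :: Γ) σ := .var (.s (.s .z))

/-- The numeral `1`. -/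
def numOne : Term Γ Ty.nat := .succ ⬝ .zero

/-- The function `r, n ↦ r + 1`. -/
def succFst : Term Γ (Ty.nat ⇢ Ty.nat ⇢ Ty.nat) :=
  .S _ _ _ ⬝ (.K _ Ty.nat ⬝ .K Ty.nat Ty.nat) ⬝ .succ

/-- Addition `x, y ↦ x + y`, defined by `x + 0 = x` and `x + (y + 1) = (x + y) + 1`. -/
def add : Term Γ (Ty.nat ⇢ Ty.nat ⇢ Ty.nat) :=
  .S _ _ _ ⬝ .R ⬝ (.K _ Ty.nat ⬝ succFst)

/-- `l ↦ 0 + 1 + ⋯ + (l - 1)`. -/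
def tri : Term Γ Ty.one := .R ⬝ .zero ⬝ add

/-- The code `l (l - 1) / 2 + k` of the pair `{k, l}` with `k < l`. This is a bijection between
the set `[ℕ]²` of two-element subsets and `ℕ`, so that the functions `f : [ℕ]² → ℕ` are exactly the
objects of type `1`. -/
def pairCode (k l : Term Γ Ty.nat) : Term Γ Ty.nat := add ⬝ (tri ⬝ l) ⬝ k

/-- `a ≤ b`. -/
def le (a b : Term Γ Ty.nat) : Formula Γ := ex Ty.nat (add ⬝ a.wk _ ⬝ v0 ≐ b.wk _)

/-- `a < b`. -/
def lt (a b : Term Γ Ty.nat) : Formula Γ := le (.succ ⬝ a) b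

/-- `f` and `g` have the same initial segment of length `n`. -/
def agree (f g : Term Γ Ty.one) (n : Term Γ Ty.nat) : Formula Γ :=
  all Ty.nat (lt v0 (n.wk _) ⇾ f.wk _ ⬝ v0 ≐ g.wk _ ⬝ v0)

/-! ### Sets, given by characteristic functions -/

/-- `A` is binary, that is, `A` is the characteristic function of a set. -/
def isSet (A : Term Γ Ty.one) : Formula Γ :=
  all Ty.nat (A.wk _ ⬝ v0 ≐ .zero ⋁ A.wk _ ⬝ v0 ≐ numOne)

def mem (x : Term Γ Ty.nat) (A : Term Γ Ty.one) : Formula Γ := A ⬝ x ≐ numOne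

/-- The set `A` is infinite, that is, unbounded. -/
def infinite (A : Term Γ Ty.one) : Formula Γ :=
  all Ty.nat (ex Ty.nat (le v1 v0 ⋀ mem v0 ((A.wk _).wk _)))

/-- `n ∉ f([A]²)`. -/
def omits (f A : Term Γ Ty.one) (n : Term Γ Ty.nat) : Formula Γ :=
  all Ty.nat (all Ty.nat
    (lt v1 v0 ⋀ mem v1 ((A.wk _).wk _) ⋀ mem v0 ((A.wk _).wk _) ⇾
      neg ((f.wk _).wk _ ⬝ pairCode v1 v0 ≐ (n.wk _).wk _)))

/-! ### The principles -/

/-- `MU(μ)`: for all `f¹`, if `f` has a zero then `μ f` is a zero of `f`. -/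
def MU (μ : Term Γ Ty.two) : Formula Γ :=
  all Ty.one (ex Ty.nat (v1 ⬝ v0 ≐ .zero) ⇾ v0 ⬝ (μ.wk _ ⬝ v0) ≐ .zero)

/-- `UTS(Ψ)`: for all `f : [ℕ]² → ℕ`, the set `Ψ f` is infinite, and `n ∉ f([Ψ f]²)` for
some `n`. -/
def UTS (Ψ : Term Γ (Ty.one ⇢ Ty.one)) : Formula Γ :=
  all Ty.one (isSet (Ψ.wk _ ⬝ v0) ⋀ infinite (Ψ.wk _ ⬝ v0) ⋀
    ex Ty.nat (omits v1 ((Ψ.wk _).wk _ ⬝ v1) v0))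

/-- The same with the omitted number witnessed: for all `f : [ℕ]² → ℕ`, the set `Ψ f` is infinite,
and `N f ∉ f([Ψ f]²)`. -/
def UTSWit (Ψ : Term Γ (Ty.one ⇢ Ty.one)) (N : Term Γ Ty.two) : Formula Γ :=
  all Ty.one (isSet (Ψ.wk _ ⬝ v0) ⋀ infinite (Ψ.wk _ ⬝ v0) ⋀
    omits v0 (Ψ.wk _ ⬝ v0) (N.wk _ ⬝ v0))

/-- `Ξ` is an extensionality functional for `f ↦ (Ψ f, N f)`: for all `f`, `g`, `k`, if `f` and `g`
agree below `Ξ f g k`, then `Ψ f` and `Ψ g` agree below `k`, and `N f = N g`. -/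
def ExtFun (Ξ : Term Γ (Ty.one ⇢ Ty.one ⇢ Ty.nat ⇢ Ty.nat)) (Ψ : Term Γ (Ty.one ⇢ Ty.one))
    (N : Term Γ Ty.two) : Formula Γ :=
  all Ty.one (all Ty.one (all Ty.nat
    (agree v2 v1 (((Ξ.wk _).wk _).wk _ ⬝ v2 ⬝ v1 ⬝ v0) ⇾
      agree (((Ψ.wk _).wk _).wk _ ⬝ v2) (((Ψ.wk _).wk _).wk _ ⬝ v1) v0 ⋀
      ((N.wk _).wk _).wk _ ⬝ v2 ≐ ((N.wk _).wk _).wk _ ⬝ v1)))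

/-- The principle `(μ²)`. -/
def MuSq : Formula [] := ex Ty.two (MU v0)

/-- The principle `UTS(2)`. -/
def UTSTwo : Formula [] := ex (Ty.one ⇢ Ty.one) (UTS v0)

end Arithmetic

end RCAomega

open RCAomega

namespace RCAomega

open Formula

/-! ### Substitution -/

/-! Provability is established semantically. A Henkin construction gives completeness
(`provable_of_sat`): a sentence true in all extensional models of the theory is provable. It then
suffices to argue inside an arbitrary model. Its numbers may be nonstandard, so induction is
available only for predicates with a characteristic function in the model (`Dec.induction`), and
every functional used must be the value of a term or come from quantifier-free choice.

From `μ` to thin sets (`thin_spec`): with `μ`, arithmetical predicates are decidable. Choose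
greedily a set `D` whose pairs avoid the value 0, admitting a number only if infinitely many
candidates stay compatible with it and the earlier choices. If `D` is infinite, it omits 0.
Otherwise the numbers above `D` compatible with all of `D` form an infinite reservoir. No reservoir
element `x` was admitted, so `f {x, z} = 0` for all large `z` in the reservoir, and a second greedy
choice gives an infinite set on whose pairs `f` is constantly 0, so that 1 is omitted.

From witnessed thin sets with an extensionality functional to `μ` (`searchT_spec`): given `h`, let
`g` be 0 until `h` has had a zero and `N 0` afterwards, where `N 0` is the number omitted for the
zero function. If `h` has a zero, then the infinite set `Ψ g` has a pair at which `g` takes the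
value `N 0`, so `N g` differs from `N 0`. Hence `Ξ` bounds a place where `g` is nonzero, and thereby
a zero of `h`.

From `UTS(2)` alone to `μ` (`exists_isMu`): by Grilliot's trick, a functional discontinuous along a
convergent sequence yields `μ`. If there were no `μ`, then `Ψ` would be sequentially continuous. One
then builds `f` in stages, giving it the value `n` on a far interval that contains the code of a
pair from the current candidate set, while keeping the earlier decisions of `Ψ`. In the limit, every
`n` is a value of `f` on pairs from `Ψ f`, a contradiction. Once `μ` exists, it computes `N` and `Ξ`
(`IsUTS.exists_wit`). -/

theorem Term.rename_eq_subst {Γ Δ : Ctx} {σ : Ty} (r : Ren Γ Δ) (t : Term Γ σ) :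
    t.rename r = t.subst (fun _ x => .var (r _ x)) := by
  induction t <;> simp [Term.rename, Term.subst, *]

theorem Term.subst_subst {Γ Δ Θ : Ctx} {σ : Ty} (θ : Sub Γ Δ) (η : Sub Δ Θ) (t : Term Γ σ) :
    (t.subst θ).subst η = t.subst (fun _ x => (θ _ x).subst η) := by
  induction t <;> simp [Term.subst, *]

theorem Term.subst_var {Γ : Ctx} {σ : Ty} (t : Term Γ σ) :
    t.subst (fun _ x => .var x) = t := by
  induction t <;> simp [Term.subst, *]

theorem Sub.lift_var {Γ Δ : Ctx} (r : Ren Γ Δ) (τ : Ty) :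
    Sub.lift (fun _ x => .var (r _ x)) τ = fun _ x => .var (r.lift τ _ x) := by
  funext σ x
  cases x <;> rfl

theorem Sub.lift_id (Γ : Ctx) (τ : Ty) :
    Sub.lift (fun _ x => .var x : Sub Γ Γ) τ = fun _ x => .var x := by
  funext σ x
  cases x <;> rfl

theorem Term.wk_subst_lift {Γ Δ : Ctx} {σ : Ty} (θ : Sub Γ Δ) (τ : Ty) (t : Term Γ σ) :
    (t.wk τ).subst (θ.lift τ) = (t.subst θ).wk τ := by
  simp [Term.wk, Term.rename_eq_subst, Term.subst_subst, Term.subst, Sub.lift]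

theorem Term.wk_subst_single {Γ : Ctx} {σ τ : Ty} (t : Term Γ σ) (a : Term Γ τ) :
    (t.wk τ).subst (Sub.single a) = t := by
  simp [Term.wk, Term.rename_eq_subst, Term.subst_subst, Term.subst, Sub.single, Term.subst_var]

theorem Sub.lift_comp {Γ Δ Θ : Ctx} (θ : Sub Γ Δ) (η : Sub Δ Θ) (τ : Ty) :
    (fun _ x => (θ.lift τ _ x).subst (η.lift τ) : Sub (τ :: Γ) (τ :: Θ)) =
      Sub.lift (fun _ x => (θ _ x).subst η) τ := by
  funext σ x
  cases x with
  | z => rfl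
  | s x => exact Term.wk_subst_lift η τ _

namespace Formula

/-- Renamings are treated as substitutions by variables, so that the commutation facts below reduce
to the single composition law `subst_subst`. -/
theorem rename_eq_subst {Γ Δ : Ctx} (r : Ren Γ Δ) (φ : Formula Γ) :
    φ.rename r = φ.subst (fun _ x => .var (r _ x)) := by
  induction φ generalizing Δ <;>
    simp [Formula.rename, Formula.subst, Term.rename_eq_subst, Sub.lift_var, *]

theorem subst_subst {Γ Δ Θ : Ctx} (θ : Sub Γ Δ) (η : Sub Δ Θ) (φ : Formula Γ) :
    (φ.subst θ).subst η = φ.subst (fun _ x => (θ _ x).subst η) := by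
  induction φ generalizing Δ Θ <;>
    simp [Formula.subst, Term.subst_subst, Sub.lift_comp, *]

theorem subst_var {Γ : Ctx} (φ : Formula Γ) : φ.subst (fun _ x => .var x) = φ := by
  induction φ <;> simp [Formula.subst, Term.subst_var, Sub.lift_id, *]

theorem QF.subst {Γ Δ : Ctx} (θ : Sub Γ Δ) {φ : Formula Γ} (h : φ.QF) : (φ.subst θ).QF := by
  induction φ generalizing Δ with
  | eq => trivial
  | bot => trivial
  | imp φ ψ h1 h2 => exact ⟨h1 θ h.1, h2 θ h.2⟩
  | all => exact h.elim

theorem eqT_subst {Γ Δ : Ctx} (θ : Sub Γ Δ) {σ : Ty} (a b : Term Γ σ) :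
    (eqT σ a b).subst θ = eqT σ (a.subst θ) (b.subst θ) := by
  induction σ generalizing Γ Δ with
  | nat => rfl
  | arrow σ τ _ ih =>
    simp [eqT, Formula.subst, ih, Term.subst, Term.wk_subst_lift, Sub.lift]

theorem wk_inst {Γ : Ctx} {τ : Ty} (φ : Formula Γ) (a : Term Γ τ) : (φ.wk τ).inst a = φ := by
  simp [Formula.wk, Formula.inst, rename_eq_subst, subst_subst, Term.subst, Sub.single, subst_var]

theorem wk_subst_lift {Γ Δ : Ctx} (θ : Sub Γ Δ) (τ : Ty) (φ : Formula Γ) :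
    (φ.wk τ).subst (θ.lift τ) = (φ.subst θ).wk τ := by
  simp [Formula.wk, rename_eq_subst, subst_subst, Term.subst, Sub.lift, Term.wk,
    Term.rename_eq_subst]

theorem inst_subst {Γ Δ : Ctx} {τ : Ty} (θ : Sub Γ Δ) (φ : Formula (τ :: Γ)) (a : Term Γ τ) :
    (φ.inst a).subst θ = (φ.subst (θ.lift τ)).inst (a.subst θ) := by
  simp only [Formula.inst, subst_subst]
  congr 1
  funext σ x
  cases x with
  | z => rfl
  | s x => exact (Term.wk_subst_single _ _).symm

end Formula

/-! ### Closure of derivability under substitution and weakening. -/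

theorem Axiom.subst {Γ Δ : Ctx} (θ : Sub Γ Δ) {φ : Formula Γ} (h : Axiom φ) :
    Axiom (φ.subst θ) := by
  cases h with
  | succ_ne_zero a => exact .succ_ne_zero _
  | succ_inj a b => exact .succ_inj _ _
  | K a b => rw [eqT_subst]; exact .K _ _
  | S a b c => rw [eqT_subst]; exact .S _ _ _
  | R_zero a b => exact .R_zero _ _
  | R_succ a b c => exact .R_succ _ _ _
  | ext f a b =>
    simp only [Formula.subst, eqT_subst]
    exact .ext _ _ _
  | ind φ hφ =>
    have h1 := Formula.inst_subst θ φ .zero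
    have h2 : (φ.subst Sub.next).subst (θ.lift _) = (φ.subst (θ.lift _)).subst Sub.next := by
      simp only [subst_subst]
      congr 1
      funext σ x
      cases x with
      | z => rfl
      | s x =>
        simp [Sub.next, Sub.lift, Term.subst, Term.wk, Term.rename_eq_subst, Term.subst_subst]
    have := Axiom.ind (φ.subst (θ.lift _)) (hφ.subst _)
    simp only [Formula.subst, Formula.and, Formula.neg, h1, h2] at this ⊢
    exact this
  | qfac φ hφ =>
    have h2 : (φ.subst Sub.choice).subst ((θ.lift _).lift _) =
        (φ.subst ((θ.lift _).lift _)).subst Sub.choice := by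
      simp only [subst_subst]
      congr 1
      funext σ x
      rcases x with _ | x
      · rfl
      · rcases x with _ | x
        · rfl
        · simp [Sub.choice, Sub.lift, Term.subst, Term.wk, Term.rename_eq_subst,
            Term.subst_subst]
    have := Axiom.qfac (φ.subst ((θ.lift _).lift _)) (hφ.subst _)
    simp only [Formula.subst, Formula.ex, Formula.neg, h2] at this ⊢
    exact this

/-- The freedom in `H'` makes weakening of the hypotheses (`Derives.mono`) and of the context
(`Derives.wk`) special cases. -/
theorem Derives.subst {Γ Δ : Ctx} {H : List (Formula Γ)} {φ : Formula Γ} (h : Derives H φ)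
    (θ : Sub Γ Δ) {H' : List (Formula Δ)} (hH : ∀ ψ ∈ H, ψ.subst θ ∈ H') :
    Derives H' (φ.subst θ) := by
  induction h generalizing Δ with
  | ax h => exact .ax (h.subst θ)
  | hyp h => exact .hyp (hH _ h)
  | impI _ ih =>
    refine .impI (ih θ ?_)
    intro ψ hψ
    rcases List.mem_cons.1 hψ with rfl | hψ
    · exact List.mem_cons_self
    · exact List.mem_cons_of_mem _ (hH _ hψ)
  | impE _ _ ih1 ih2 => exact .impE (ih1 θ hH) (ih2 θ hH)
  | raa _ ih =>
    refine .raa (ih θ ?_)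
    intro ψ hψ
    rcases List.mem_cons.1 hψ with rfl | hψ
    · exact List.mem_cons_self
    · exact List.mem_cons_of_mem _ (hH _ hψ)
  | allI _ ih =>
    refine .allI (ih (θ.lift _) ?_)
    intro ψ hψ
    obtain ⟨χ, hχ, rfl⟩ := List.mem_map.1 hψ
    rw [Formula.wk_subst_lift]
    exact List.mem_map_of_mem (hH _ hχ)
  | allE t _ ih =>
    rw [Formula.inst_subst]
    exact .allE _ (ih θ hH)
  | eqI a => exact .eqI _
  | eqE φ _ _ ih1 ih2 =>
    rw [Formula.inst_subst]
    have := ih2 θ hH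
    rw [Formula.inst_subst] at this
    exact .eqE _ (ih1 θ hH) this

theorem Derives.mono {Γ : Ctx} {H H' : List (Formula Γ)} {φ : Formula Γ} (h : Derives H φ)
    (hH : H ⊆ H') : Derives H' φ := by
  simpa [Formula.subst_var] using
    h.subst (fun _ x => .var x) (H' := H')
      fun ψ hψ => by rw [Formula.subst_var]; exact hH hψ

theorem Derives.wk {Γ : Ctx} {H : List (Formula Γ)} {φ : Formula Γ} (h : Derives H φ) (τ : Ty) :
    Derives (H.map (Formula.wk τ)) (φ.wk τ) := by
  rw [Formula.wk, Formula.rename_eq_subst]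
  refine h.subst _ fun ψ hψ => ?_
  rw [← Formula.rename_eq_subst]
  exact List.mem_map_of_mem hψ

theorem Derives.exfalso {Γ : Ctx} {H : List (Formula Γ)} {φ : Formula Γ} (h : Derives H bot) :
    Derives H φ :=
  .raa (h.mono (List.subset_cons_self _ _))

/-! ### Countability of the syntax -/

def Ty.code : Ty → ℕ
  | .nat => 0
  | .arrow a b => Nat.pair a.code b.code + 1

theorem Ty.code_injective : Function.Injective Ty.code := by
  intro a
  induction a with
  | nat => intro b h; cases b <;> simp_all [Ty.code]
  | arrow a b iha ihb =>
    intro c h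
    cases c with
    | nat => simp [Ty.code] at h
    | arrow c d =>
      simp only [Ty.code, Nat.add_right_cancel_iff, Nat.pair_eq_pair] at h
      rw [iha h.1, ihb h.2]

instance : Inhabited Ty := ⟨.nat⟩

instance : Countable Ty := Ty.code_injective.countable

def Var.code {Γ : Ctx} {σ : Ty} : Var Γ σ → ℕ
  | .z => 0
  | .s x => x.code + 1

theorem Var.code_injective {Γ : Ctx} {σ τ : Ty} (x : Var Γ σ) (y : Var Γ τ)
    (h : x.code = y.code) : σ = τ ∧ HEq x y := by
  induction x with
  | z =>
    cases y with
    | z => exact ⟨rfl, .rfl⟩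
    | s y => simp [Var.code] at h
  | s x ih =>
    cases y with
    | z => simp [Var.code] at h
    | s y =>
      obtain ⟨rfl, h⟩ := ih y (by simpa [Var.code] using h)
      cases h
      exact ⟨rfl, .rfl⟩

def Term.code {Γ : Ctx} {σ : Ty} : Term Γ σ → ℕ
  | .var x => Nat.pair 0 x.code
  | .app a b => Nat.pair 1 (Nat.pair a.code b.code)
  | .zero => Nat.pair 2 0
  | .succ => Nat.pair 3 0
  | .K σ τ => Nat.pair 4 (Nat.pair σ.code τ.code)
  | .S ρ σ τ => Nat.pair 5 (Nat.pair ρ.code (Nat.pair σ.code τ.code))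
  | .R => Nat.pair 6 0

/-- The argument type of an application does not appear in its type, so the induction must compare
terms of different types and recover the type from the code. -/
theorem Term.code_injective' {Γ : Ctx} {σ τ : Ty} (a : Term Γ σ) (b : Term Γ τ)
    (h : a.code = b.code) : σ = τ ∧ HEq a b := by
  induction a generalizing τ with
  | var x =>
    cases b <;> simp only [Term.code, Nat.pair_eq_pair] at h <;> try omega
    obtain ⟨rfl, h⟩ := Var.code_injective _ _ h.2
    cases h
    exact ⟨rfl, .rfl⟩
  | app a a' ih ih' =>
    cases b <;> simp only [Term.code, Nat.pair_eq_pair] at h <;> try omega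
    obtain ⟨h1, h2⟩ := ih _ h.2.1
    obtain ⟨rfl, h3⟩ := ih' _ h.2.2
    cases h1
    cases h2
    cases h3
    exact ⟨rfl, .rfl⟩
  | zero => cases b <;> simp only [Term.code, Nat.pair_eq_pair] at h <;> first | omega | simp
  | succ => cases b <;> simp only [Term.code, Nat.pair_eq_pair] at h <;> first | omega | simp
  | R => cases b <;> simp only [Term.code, Nat.pair_eq_pair] at h <;> first | omega | simp
  | K σ τ =>
    cases b <;> simp only [Term.code, Nat.pair_eq_pair] at h <;> try omega
    obtain rfl := Ty.code_injective h.2.1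
    obtain rfl := Ty.code_injective h.2.2
    exact ⟨rfl, .rfl⟩
  | S ρ σ τ =>
    cases b <;> simp only [Term.code, Nat.pair_eq_pair] at h <;> try omega
    obtain rfl := Ty.code_injective h.2.1
    obtain rfl := Ty.code_injective h.2.2.1
    obtain rfl := Ty.code_injective h.2.2.2
    exact ⟨rfl, .rfl⟩

theorem Term.code_injective {Γ : Ctx} {σ : Ty} : Function.Injective (Term.code (Γ := Γ) (σ := σ)) :=
  fun a b h => eq_of_heq (Term.code_injective' a b h).2

def Formula.code : {Γ : Ctx} → Formula Γ → ℕ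
  | _, .eq a b => Nat.pair 0 (Nat.pair a.code b.code)
  | _, .bot => Nat.pair 1 0
  | _, .imp φ ψ => Nat.pair 2 (Nat.pair φ.code ψ.code)
  | _, .all σ φ => Nat.pair 3 (Nat.pair σ.code φ.code)

theorem Formula.code_injective {Γ : Ctx} : Function.Injective (Formula.code (Γ := Γ)) := by
  intro φ
  induction φ with
  | eq a b =>
    intro ψ h
    cases ψ <;> simp only [Formula.code, Nat.pair_eq_pair] at h <;> try omega
    rw [Term.code_injective h.2.1, Term.code_injective h.2.2]
  | bot =>
    intro ψ h
    cases ψ <;> simp only [Formula.code, Nat.pair_eq_pair] at h <;> first | omega | rfl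
  | imp φ φ' ih ih' =>
    intro ψ h
    cases ψ <;> simp only [Formula.code, Nat.pair_eq_pair] at h <;> try omega
    rw [ih h.2.1, ih' h.2.2]
  | all σ φ ih =>
    intro ψ h
    cases ψ <;> simp only [Formula.code, Nat.pair_eq_pair] at h <;> try omega
    obtain rfl := Ty.code_injective h.2.1
    rw [ih h.2.2]

instance {Γ : Ctx} : Countable (Formula Γ) := Formula.code_injective.countable

/-! ### Henkin sequences -/

/-- The context of the first `n` variables of a sequence of typed variables. -/
def ctx (τ : ℕ → Ty) : ℕ → Ctx
  | 0 => []
  | n + 1 => τ n :: ctx τ n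

/-- The weakening from the first `m` to the first `n` variables. -/
def up (τ : ℕ → Ty) {m n : ℕ} (h : m ≤ n) : Ren (ctx τ m) (ctx τ n) :=
  Nat.leRec (motive := fun n _ => Ren (ctx τ m) (ctx τ n)) (fun _ x => x)
    (fun _ _ r σ x => Var.s (r σ x)) h

theorem up_self (τ : ℕ → Ty) (m : ℕ) : up τ (le_refl m) = fun _ x => x := Nat.leRec_self _ _

theorem up_succ (τ : ℕ → Ty) {m n : ℕ} (h : m ≤ n) :
    up τ (Nat.le_succ_of_le h) = fun σ x => Var.s (up τ h σ x) := Nat.leRec_succ _ _ h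

theorem up_up (τ : ℕ → Ty) {m n k : ℕ} (h : m ≤ n) (h' : n ≤ k) {σ : Ty} (x : Var (ctx τ m) σ) :
    up τ h' σ (up τ h σ x) = up τ (h.trans h') σ x := by
  induction h' with
  | refl => rw [up_self]
  | step h' ih =>
    rw [up_succ τ (show n ≤ _ from h'), up_succ τ (h.trans h')]
    exact congrArg _ ih

/-- `φ` enumerates all formulas with a distinguished variable, over the contexts `ctx τ m`. -/
def Fair (τ : ℕ → Ty) (φ : ∀ n, Formula (τ n :: ctx τ n)) : Prop :=
  ∀ (m : ℕ) (σ : Ty) (ψ : Formula (σ :: ctx τ m)),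
    ∃ (n : ℕ) (h : m ≤ n) (e : σ = τ n), φ n = (e ▸ ψ).rename ((up τ h).lift (τ n))

/-- The contexts depend on `τ`, so the types are fixed before any formula is enumerated. Stage `⟨i,
⟨j, m⟩⟩` has the `i`-th type and treats the `j`-th formula for that type; the component `m` only
makes the stage late enough for the context of the formula. -/
theorem exists_fair : ∃ (τ : ℕ → Ty) (φ : ∀ n, Formula (τ n :: ctx τ n)), Fair τ φ := by
  obtain ⟨enum, henum⟩ := exists_surjective_nat Ty
  let τ : ℕ → Ty := fun n => enum n.unpair.1
  have key : ∀ σ : Ty, ∃ e : ℕ → Σ m, Formula (σ :: ctx τ m), Function.Surjective e :=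
    fun σ => by
      have : Nonempty (Σ m, Formula (σ :: ctx τ m)) := ⟨⟨0, .bot⟩⟩
      exact exists_surjective_nat _
  choose e he using key
  let φ : ∀ n, Formula (τ n :: ctx τ n) := fun n =>
    if h : (e (τ n) n.unpair.2.unpair.1).1 ≤ n then
      (e (τ n) n.unpair.2.unpair.1).2.rename ((up τ h).lift (τ n)) else .bot
  refine ⟨τ, φ, ?_⟩
  intro m σ ψ
  obtain ⟨i, rfl⟩ := henum σ
  obtain ⟨j, hj⟩ := he (enum i) ⟨m, ψ⟩
  have hτ : enum i = τ (Nat.pair i (Nat.pair j m)) := by simp [τ]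
  have hm : m ≤ Nat.pair i (Nat.pair j m) :=
    (Nat.right_le_pair _ _).trans (Nat.right_le_pair _ _)
  refine ⟨Nat.pair i (Nat.pair j m), hm, hτ, ?_⟩
  have hj' : e (τ (Nat.pair i (Nat.pair j m))) (Nat.pair i (Nat.pair j m)).unpair.2.unpair.1 =
      ⟨m, hτ ▸ ψ⟩ := by
    have : (Nat.pair i (Nat.pair j m)).unpair.2.unpair.1 = j := by simp
    rw [this]
    clear this hm
    revert hτ
    generalize τ (Nat.pair i (Nat.pair j m)) = σ
    rintro rfl
    exact hj
  simp only [φ]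
  revert hj'
  generalize e (τ (Nat.pair i (Nat.pair j m)))
    (Nat.pair i (Nat.pair j m)).unpair.2.unpair.1 = p
  rintro rfl
  rw [dif_pos hm]

open Classical in
/-- The hypotheses of a Henkin sequence: at the stage `n`, the new variable is made a
counterexample to `∀ x, φ n x`, unless this formula is derivable. -/
noncomputable def hyps (τ : ℕ → Ty) (φ : ∀ n, Formula (τ n :: ctx τ n)) (H : List (Formula [])) :
    ∀ n, List (Formula (ctx τ n))
  | 0 => H
  | n + 1 => (if Derives (hyps τ φ H n) (all (τ n) (φ n)) then [] else [neg (φ n)]) ++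
      (hyps τ φ H n).map (Formula.wk (τ n))

/-- The closed term of type `σ` that is constantly zero. -/
def Term.default {Γ : Ctx} : (σ : Ty) → Term Γ σ
  | .nat => .zero
  | .arrow σ τ => .K τ σ ⬝ Term.default τ

/-- Every type has a closed term, so a variable that is not used can be discharged by instantiation.
-/
theorem Derives.of_wk_bot {Γ : Ctx} {H : List (Formula Γ)} {σ : Ty}
    (h : Derives (H.map (Formula.wk σ)) bot) : Derives H bot :=
  .allE (φ := bot) (Term.default σ) (.allI h)

section Henkin

variable {τ : ℕ → Ty} {φ : ∀ n, Formula (τ n :: ctx τ n)} {H : List (Formula [])}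

/-- If adding `neg (φ n)` were inconsistent, then `φ n` would be derivable for a fresh variable, and
so would its generalization, which the case distinction excludes. -/
theorem hyps_consistent (hH : ¬ Derives H bot) (n : ℕ) : ¬ Derives (hyps τ φ H n) bot := by
  induction n with
  | zero => exact hH
  | succ n ih =>
    rw [hyps]
    split_ifs with h
    · exact fun h' => ih h'.of_wk_bot
    · exact fun h' => h (.allI (.raa h'))

theorem rename_up_succ {m n : ℕ} (h : m ≤ n) (ψ : Formula (ctx τ m)) :
    ψ.rename (up τ (Nat.le_succ_of_le h)) = (ψ.rename (up τ h)).wk (τ n) := by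
  rw [up_succ τ h, Formula.wk]
  simp only [rename_eq_subst ((fun _ x => Var.s x : Ren _ _)), rename_eq_subst (up τ h),
    subst_subst, Term.subst]
  exact rename_eq_subst (Δ := τ n :: ctx τ n) _ _

theorem hyps_mono {m n : ℕ} (h : m ≤ n) {ψ : Formula (ctx τ m)} (hψ : Derives (hyps τ φ H m) ψ) :
    Derives (hyps τ φ H n) (ψ.rename (up τ h)) := by
  induction h with
  | refl => rw [up_self, rename_eq_subst, subst_var]; exact hψ
  | @step k h ih =>
    have := (ih.wk (τ k)).mono (H' := hyps τ φ H (k + 1)) (List.subset_append_right _ _)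
    rwa [← rename_up_succ (show m ≤ k from h)] at this

/-- Truth in the limit of a Henkin sequence. -/
def Holds (τ : ℕ → Ty) (φ : ∀ n, Formula (τ n :: ctx τ n)) (H : List (Formula [])) (n : ℕ)
    (ψ : Formula (ctx τ n)) : Prop :=
  ∃ (N : ℕ) (h : n ≤ N), Derives (hyps τ φ H N) (ψ.rename (up τ h))

theorem rename_up_up {m n k : ℕ} (h : m ≤ n) (h' : n ≤ k) (ψ : Formula (ctx τ m)) :
    (ψ.rename (up τ h)).rename (up τ h') = ψ.rename (up τ (h.trans h')) := by
  simp only [rename_eq_subst, subst_subst, Term.subst, up_up]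

theorem Holds.eventually {n : ℕ} {ψ : Formula (ctx τ n)} (h : Holds τ φ H n ψ) :
    ∃ N, ∀ k (hk : n ≤ k), N ≤ k → Derives (hyps τ φ H k) (ψ.rename (up τ hk)) := by
  obtain ⟨N, hN, h⟩ := h
  refine ⟨N, fun k hk hNk => ?_⟩
  have := hyps_mono hNk h
  rwa [rename_up_up] at this

theorem Holds.of_derives {n : ℕ} {ψ : Formula (ctx τ n)} (h : Derives (hyps τ φ H n) ψ) :
    Holds τ φ H n ψ :=
  ⟨n, le_rfl, hyps_mono _ h⟩

theorem holds_up {m n : ℕ} (h : m ≤ n) (ψ : Formula (ctx τ m)) :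
    Holds τ φ H n (ψ.rename (up τ h)) ↔ Holds τ φ H m ψ := by
  constructor
  · rintro ⟨N, hN, h'⟩
    rw [rename_up_up] at h'
    exact ⟨N, _, h'⟩
  · intro h'
    obtain ⟨N, hN⟩ := h'.eventually
    refine ⟨max N n, le_max_right _ _, ?_⟩
    rw [rename_up_up]
    exact hN _ _ (le_max_left _ _)

theorem Holds.mp {n : ℕ} {ψ χ : Formula (ctx τ n)} (h : Holds τ φ H n (ψ ⇾ χ))
    (h' : Holds τ φ H n ψ) : Holds τ φ H n χ := by
  obtain ⟨N, hN⟩ := h.eventually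
  obtain ⟨N', hN'⟩ := h'.eventually
  refine ⟨max n (max N N'), le_max_left _ _, ?_⟩
  exact .impE (hN _ _ (by simp)) (hN' _ _ (by simp))

theorem not_holds_bot (hH : ¬ Derives H bot) {n : ℕ} : ¬ Holds τ φ H n bot :=
  fun ⟨_, _, h⟩ => hyps_consistent hH _ h

/-- The Henkin sequence also decides every formula: fairness is applied to `ψ` with a dummy
variable, for which a counterexample amounts to `neg ψ`. -/
theorem Holds.dec (hF : Fair τ φ) {n : ℕ} (ψ : Formula (ctx τ n)) :
    Holds τ φ H n ψ ∨ Holds τ φ H n (neg ψ) := by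
  obtain ⟨N, hN, e, hφ⟩ := hF n (τ n) (ψ.wk _)
  have hφ' : φ N = (ψ.rename (up τ hN)).wk _ := by
    rw [hφ]
    clear hφ
    revert e
    generalize τ N = σ
    rintro rfl
    simp only [Formula.wk, rename_eq_subst, subst_subst, Term.subst]
    rfl
  by_cases h : Derives (hyps τ φ H N) (all (τ N) (φ N))
  · left
    have := Derives.allE (Term.default _) h
    rw [hφ', Formula.wk_inst] at this
    exact ⟨N, hN, this⟩
  · right
    refine ⟨N + 1, Nat.le_succ_of_le hN, .hyp ?_⟩
    rw [hyps, if_neg h, hφ', rename_up_succ hN]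
    exact List.mem_append_left _ (List.mem_singleton.2 rfl)

theorem holds_imp (hF : Fair τ φ) {n : ℕ} {ψ χ : Formula (ctx τ n)} :
    Holds τ φ H n (ψ ⇾ χ) ↔ (Holds τ φ H n ψ → Holds τ φ H n χ) := by
  refine ⟨Holds.mp, fun h => ?_⟩
  rcases Holds.dec (H := H) hF ψ with hψ | hψ
  · obtain ⟨N, hN, hχ⟩ := h hψ
    exact ⟨N, hN, .impI (hχ.mono (List.subset_cons_self _ _))⟩
  · obtain ⟨N, hN, hψ⟩ := hψ
    refine ⟨N, hN, .impI (Derives.exfalso ?_)⟩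
    exact .impE (hψ.mono (List.subset_cons_self _ _)) (.hyp List.mem_cons_self)

/-- Instances at all later stages are needed, since new elements keep appearing. Conversely, at a
stage that treats `ψ`, failure of the quantified formula makes the new variable a counterexample. -/
theorem holds_all (hH : ¬ Derives H bot) (hF : Fair τ φ) {n : ℕ} {σ : Ty}
    {ψ : Formula (σ :: ctx τ n)} :
    Holds τ φ H n (all σ ψ) ↔ ∀ (N : ℕ) (h : n ≤ N) (t : Term (ctx τ N) σ),
      Holds τ φ H N ((ψ.rename ((up τ h).lift σ)).inst t) := by
  constructor
  · intro h N hN t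
    obtain ⟨k, hk, h'⟩ := (holds_up hN _).2 h
    refine ⟨k, hk, ?_⟩
    have := h'.allE (t.rename (up τ hk))
    convert this using 1
    simp only [Formula.inst, rename_eq_subst, subst_subst, Term.rename_eq_subst]
    congr 1
    funext ρ x
    cases x <;> rfl
  · intro h
    obtain ⟨N, hN, e, hφ⟩ := hF n σ ψ
    subst e
    by_cases h' : Derives (hyps τ φ H N) (all (τ N) (φ N))
    · rw [hφ] at h'
      exact ⟨N, hN, h'⟩
    · exfalso
      have h1 : Holds τ φ H (N + 1) (neg (φ N)) := by
        refine .of_derives (.hyp ?_)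
        rw [hyps, if_neg h']
        exact List.mem_append_left _ (List.mem_singleton.2 rfl)
      have h2 := h (N + 1) (Nat.le_succ_of_le hN) (.var .z)
      refine not_holds_bot hH (h1.mp ?_)
      rw [hφ]
      refine (congrArg (Holds τ φ H (N + 1)) ?_).mp h2
      simp only [Formula.inst, rename_eq_subst, subst_subst, Term.subst]
      congr 1
      funext ρ x
      cases x with
      | z => rfl
      | s x =>
        rw [up_succ τ hN]
        rfl

end Henkin

/-! ### Models -/

/-- A structure for the language. -/
structure Struc where
  C : Ty → Type
  app {σ τ : Ty} : C (σ ⇢ τ) → C σ → C τ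
  zero : C Ty.nat
  succ : C Ty.one
  K (σ τ : Ty) : C (σ ⇢ τ ⇢ σ)
  S (ρ σ τ : Ty) : C ((ρ ⇢ σ ⇢ τ) ⇢ (ρ ⇢ σ) ⇢ ρ ⇢ τ)
  R : C (Ty.nat ⇢ (Ty.nat ⇢ Ty.nat ⇢ Ty.nat) ⇢ Ty.nat ⇢ Ty.nat)

/-- Application in a structure. -/
def ap {M : Struc} {σ τ : Ty} (f : M.C (σ ⇢ τ)) (x : M.C σ) : M.C τ := M.app f x

infixl:80 " ◇ " => ap

/-- Assignments of elements to the variables of a context. -/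
abbrev Env (M : Struc) (Γ : Ctx) : Type := ∀ σ : Ty, Var Γ σ → M.C σ

def Env.nil {M : Struc} : Env M [] := fun _ x => nomatch x

def Env.cons {M : Struc} {Γ : Ctx} {τ : Ty} (c : M.C τ) (ρ : Env M Γ) : Env M (τ :: Γ)
  | _, .z => c
  | _, .s x => ρ _ x

/-- The value of a term. -/
def Term.eval {M : Struc} {Γ : Ctx} (ρ : Env M Γ) : {σ : Ty} → Term Γ σ → M.C σ
  | _, .var x => ρ _ x
  | _, .app a b => a.eval ρ ◇ b.eval ρ
  | _, .zero => M.zero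
  | _, .succ => M.succ
  | _, .K σ τ => M.K σ τ
  | _, .S ρ σ τ => M.S ρ σ τ
  | _, .R => M.R

/-- Truth of a formula in a structure. -/
def Formula.Sat {M : Struc} : {Γ : Ctx} → Env M Γ → Formula Γ → Prop
  | _, ρ, .eq a b => a.eval ρ = b.eval ρ
  | _, _, .bot => False
  | _, ρ, .imp φ ψ => φ.Sat ρ → ψ.Sat ρ
  | _, ρ, .all _ φ => ∀ c, φ.Sat (ρ.cons c)

section Sat

variable {M : Struc} {Γ Δ : Ctx}

theorem Term.eval_subst (θ : Sub Γ Δ) (ρ : Env M Δ) {σ : Ty} (t : Term Γ σ) :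
    (t.subst θ).eval ρ = t.eval (fun _ x => (θ _ x).eval ρ) := by
  induction t <;> simp [Term.subst, Term.eval, *]

theorem Term.eval_rename (r : Ren Γ Δ) (ρ : Env M Δ) {σ : Ty} (t : Term Γ σ) :
    (t.rename r).eval ρ = t.eval (fun _ x => ρ _ (r _ x)) := by
  induction t <;> simp [Term.rename, Term.eval, *]

theorem Term.eval_wk (ρ : Env M Γ) {σ τ : Ty} (c : M.C τ) (t : Term Γ σ) :
    (t.wk τ).eval (ρ.cons c) = t.eval ρ :=
  Term.eval_rename _ _ _

theorem Formula.sat_subst (θ : Sub Γ Δ) (ρ : Env M Δ) (φ : Formula Γ) :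
    (φ.subst θ).Sat ρ ↔ φ.Sat (fun _ x => (θ _ x).eval ρ) := by
  induction φ generalizing Δ with
  | eq a b => simp only [Formula.subst, Sat, Term.eval_subst]
  | bot => rfl
  | imp φ ψ ih ih' => simp only [Formula.subst, Sat, ih, ih']
  | all σ φ ih =>
    simp only [Formula.subst, Sat, ih]
    refine forall_congr' fun c => iff_of_eq (congrArg (fun ρ => Sat ρ φ) ?_)
    funext τ x
    cases x with
    | z => rfl
    | s x => exact Term.eval_wk _ _ _

theorem Formula.sat_eqT (hM : ∀ {σ τ : Ty} (f g : M.C (σ ⇢ τ)), (∀ x, f ◇ x = g ◇ x) → f = g)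
    (ρ : Env M Γ) {σ : Ty} (a b : Term Γ σ) : (eqT σ a b).Sat ρ ↔ a.eval ρ = b.eval ρ := by
  induction σ generalizing Γ with
  | nat => rfl
  | arrow σ τ _ ih =>
    simp only [eqT, Sat, ih, Term.eval, Term.eval_wk, Env.cons]
    exact ⟨hM _ _, fun h _ => by rw [h]⟩

end Sat

/-- The extensional models of `RCA₀^ω`. -/
structure Model extends Struc where
  ext {σ τ : Ty} (f g : C (σ ⇢ τ)) : (∀ x, f ◇ x = g ◇ x) → f = g
  succ_ne_zero (a : C Ty.nat) : succ ◇ a ≠ zero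
  succ_inj (a b : C Ty.nat) : succ ◇ a = succ ◇ b → a = b
  K_ap {σ τ : Ty} (a : C σ) (b : C τ) : K σ τ ◇ a ◇ b = a
  S_ap {ρ σ τ : Ty} (a : C (ρ ⇢ σ ⇢ τ)) (b : C (ρ ⇢ σ)) (c : C ρ) :
    S ρ σ τ ◇ a ◇ b ◇ c = a ◇ c ◇ (b ◇ c)
  R_zero (a : C Ty.nat) (b : C (Ty.nat ⇢ Ty.nat ⇢ Ty.nat)) : R ◇ a ◇ b ◇ zero = a
  R_succ (a : C Ty.nat) (b : C (Ty.nat ⇢ Ty.nat ⇢ Ty.nat)) (c : C Ty.nat) :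
    R ◇ a ◇ b ◇ (succ ◇ c) = b ◇ (R ◇ a ◇ b ◇ c) ◇ c
  ind {Γ : Ctx} (φ : Formula (Ty.nat :: Γ)) (hφ : φ.QF) (ρ : Env toStruc Γ) :
    φ.Sat (ρ.cons zero) → (∀ c, φ.Sat (ρ.cons c) → φ.Sat (ρ.cons (succ ◇ c))) →
      ∀ c, φ.Sat (ρ.cons c)
  qfac (G : C (Ty.one ⇢ Ty.nat ⇢ Ty.nat)) :
    (∀ f, ∃ x, G ◇ f ◇ x = zero) →
      ∃ F : C Ty.two, ∀ f, ap (M := toStruc) (G ◇ f) (F ◇ f) = zero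

/-! ### The term model of a Henkin sequence -/

section TermModel

variable {τ : ℕ → Ty} {φ : ∀ n, Formula (τ n :: ctx τ n)} {H : List (Formula [])}

/-- Provable equality at a stage of a Henkin sequence. -/
def HEqT (τ : ℕ → Ty) (φ : ∀ n, Formula (τ n :: ctx τ n)) (H : List (Formula [])) (n : ℕ)
    {σ : Ty} (a b : Term (ctx τ n) σ) : Prop := Holds τ φ H n (eqT σ a b)

theorem hEqT_up {m n : ℕ} (h : m ≤ n) {σ : Ty} (a b : Term (ctx τ m) σ) :
    HEqT τ φ H n (a.rename (up τ h)) (b.rename (up τ h)) ↔ HEqT τ φ H m a b := by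
  rw [HEqT, Term.rename_eq_subst, Term.rename_eq_subst, ← eqT_subst, ← rename_eq_subst, holds_up]
  rfl

theorem Term.rename_up_self {n : ℕ} {σ : Ty} (t : Term (ctx τ n) σ) :
    t.rename (up τ (le_refl n)) = t := by
  rw [up_self, Term.rename_eq_subst, Term.subst_var]

theorem Term.rename_up_up {m n k : ℕ} (h : m ≤ n) (h' : n ≤ k) {σ : Ty} (t : Term (ctx τ m) σ) :
    (t.rename (up τ h)).rename (up τ h') = t.rename (up τ (h.trans h')) := by
  simp only [Term.rename_eq_subst, Term.subst_subst, Term.subst, up_up]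

/-- Equality at an arrow type is a universal formula, so `holds_all` makes it pointwise equality;
the term model is extensional for this reason. -/
theorem hEqT_arrow (hH : ¬ Derives H bot) (hF : Fair τ φ) {n : ℕ} {σ ρ : Ty}
    {f g : Term (ctx τ n) (σ ⇢ ρ)} :
    HEqT τ φ H n f g ↔ ∀ (N : ℕ) (h : n ≤ N) (t : Term (ctx τ N) σ),
      HEqT τ φ H N (f.rename (up τ h) ⬝ t) (g.rename (up τ h) ⬝ t) := by
  unfold HEqT
  rw [eqT, holds_all hH hF]
  refine forall_congr' fun N => forall_congr' fun h => forall_congr' fun t => ?_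
  simp only [Formula.inst, rename_eq_subst, eqT_subst, Term.wk, Term.rename_eq_subst, Term.subst,
    Term.subst_subst]
  rfl

theorem HEqT.refl (hH : ¬ Derives H bot) (hF : Fair τ φ) {n : ℕ} {σ : Ty}
    (a : Term (ctx τ n) σ) : HEqT τ φ H n a a := by
  induction σ generalizing n with
  | nat => exact .of_derives (.eqI _)
  | arrow σ ρ _ ih => exact (hEqT_arrow hH hF).2 fun N h t => ih _

theorem Derives.symm {Γ : Ctx} {H : List (Formula Γ)} {a b : Term Γ Ty.nat}
    (h : Derives H (a ≐ b)) : Derives H (b ≐ a) := by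
  have := Derives.eqE (v0 ≐ a.wk _) h
  simp only [Formula.inst, Formula.subst, Term.wk_subst_single] at this
  exact this (.eqI a)

theorem Derives.trans {Γ : Ctx} {H : List (Formula Γ)} {a b c : Term Γ Ty.nat}
    (h : Derives H (a ≐ b)) (h' : Derives H (b ≐ c)) : Derives H (a ≐ c) := by
  have := Derives.eqE (a.wk _ ≐ v0) h'
  simp only [Formula.inst, Formula.subst, Term.wk_subst_single] at this
  exact this h

theorem HEqT.symm (hH : ¬ Derives H bot) (hF : Fair τ φ) {n : ℕ} {σ : Ty}
    {a b : Term (ctx τ n) σ} (h : HEqT τ φ H n a b) : HEqT τ φ H n b a := by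
  induction σ generalizing n with
  | nat =>
    obtain ⟨N, hN, h⟩ := h
    exact ⟨N, hN, h.symm⟩
  | arrow σ ρ _ ih =>
    rw [hEqT_arrow hH hF] at h ⊢
    exact fun N hN t => ih (h N hN t)

theorem HEqT.trans (hH : ¬ Derives H bot) (hF : Fair τ φ) {n : ℕ} {σ : Ty}
    {a b c : Term (ctx τ n) σ} (h : HEqT τ φ H n a b) (h' : HEqT τ φ H n b c) :
    HEqT τ φ H n a c := by
  induction σ generalizing n with
  | nat =>
    obtain ⟨N, hN⟩ := h.eventually
    obtain ⟨N', hN'⟩ := h'.eventually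
    exact ⟨max n (max N N'), le_max_left _ _,
      (hN _ (le_max_left _ _) (by simp)).trans (hN' _ (le_max_left _ _) (by simp))⟩
  | arrow σ ρ _ ih =>
    rw [hEqT_arrow hH hF] at h h' ⊢
    exact fun N hN t => ih (h N hN t) (h' N hN t)

/-- The function is exchanged pointwise, the argument by the axiom of extensionality. This makes
application well defined on classes. -/
theorem HEqT.app (hH : ¬ Derives H bot) (hF : Fair τ φ) {n : ℕ} {σ ρ : Ty}
    {f g : Term (ctx τ n) (σ ⇢ ρ)} {a b : Term (ctx τ n) σ} (h : HEqT τ φ H n f g)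
    (h' : HEqT τ φ H n a b) : HEqT τ φ H n (f ⬝ a) (g ⬝ b) := by
  have h1 := (hEqT_arrow hH hF).1 h n le_rfl a
  rw [Term.rename_up_self, Term.rename_up_self] at h1
  exact h1.trans hH hF (Holds.mp (.of_derives (.ax (.ext g a b))) h')

/-- Equality in the limit of a Henkin sequence. -/
def LimEq (τ : ℕ → Ty) (φ : ∀ n, Formula (τ n :: ctx τ n)) (H : List (Formula [])) {σ : Ty}
    (a b : Σ n, Term (ctx τ n) σ) : Prop :=
  HEqT τ φ H (max a.1 b.1) (a.2.rename (up τ (le_max_left _ _)))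
    (b.2.rename (up τ (le_max_right _ _)))

theorem limEq_iff {σ : Ty} {a b : Σ n, Term (ctx τ n) σ} {N : ℕ} (ha : a.1 ≤ N) (hb : b.1 ≤ N) :
    LimEq τ φ H a b ↔ HEqT τ φ H N (a.2.rename (up τ ha)) (b.2.rename (up τ hb)) := by
  rw [LimEq, ← hEqT_up (max_le ha hb), Term.rename_up_up, Term.rename_up_up]

/-- Terms up to equality in the limit. -/
def limSetoid (hH : ¬ Derives H bot) (hF : Fair τ φ) (σ : Ty) :
    Setoid (Σ n, Term (ctx τ n) σ) where
  r := LimEq τ φ H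
  iseqv :=
    { refl := fun a => .refl hH hF _
      symm := fun {a b} h => by
        rw [limEq_iff (le_max_right a.1 b.1) (le_max_left a.1 b.1)]
        exact HEqT.symm hH hF h
      trans := fun {a b c} h h' => by
        have ha : a.1 ≤ max a.1 (max b.1 c.1) := by simp
        have hb : b.1 ≤ max a.1 (max b.1 c.1) := by simp
        have hc : c.1 ≤ max a.1 (max b.1 c.1) := by simp
        rw [limEq_iff ha hb] at h
        rw [limEq_iff hb hc] at h'
        rw [limEq_iff ha hc]
        exact h.trans hH hF h' }

/-- The class of a term at a stage. -/
def lim (hH : ¬ Derives H bot) (hF : Fair τ φ) (n : ℕ) {σ : Ty} (t : Term (ctx τ n) σ) :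
    Quotient (limSetoid hH hF σ) := Quotient.mk _ ⟨n, t⟩

variable (hH : ¬ Derives H bot) (hF : Fair τ φ)

theorem lim_eq_iff {n : ℕ} {σ : Ty} {a b : Term (ctx τ n) σ} :
    lim hH hF n a = lim hH hF n b ↔ HEqT τ φ H n a b := by
  rw [lim, lim, Quotient.eq]
  refine (limEq_iff (le_refl n) (le_refl n)).trans ?_
  rw [Term.rename_up_self, Term.rename_up_self]

theorem lim_up {m n : ℕ} (h : m ≤ n) {σ : Ty} (t : Term (ctx τ m) σ) :
    lim hH hF n (t.rename (up τ h)) = lim hH hF m t := by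
  refine Quotient.sound ((limEq_iff (le_refl n) h).2 ?_)
  rw [Term.rename_up_self]
  exact .refl hH hF _

theorem exists_lim {σ : Ty} (c : Quotient (limSetoid hH hF σ)) :
    ∃ n t, c = lim hH hF n t := by
  obtain ⟨⟨n, t⟩, rfl⟩ := Quotient.exists_rep c
  exact ⟨n, t, rfl⟩

/-- The term model, as a structure. -/
def limStruc : Struc where
  C σ := Quotient (limSetoid hH hF σ)
  app := Quotient.map₂ (fun f a => ⟨max f.1 a.1, f.2.rename (up τ (le_max_left _ _)) ⬝
      a.2.rename (up τ (le_max_right _ _))⟩) (by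
    intro f g h a b h'
    have hf : f.1 ≤ max (max f.1 a.1) (max g.1 b.1) := by simp
    have ha : a.1 ≤ max (max f.1 a.1) (max g.1 b.1) := by simp
    have hg : g.1 ≤ max (max f.1 a.1) (max g.1 b.1) := by simp
    have hb : b.1 ≤ max (max f.1 a.1) (max g.1 b.1) := by simp
    refine (limEq_iff (le_max_left _ _) (le_max_right _ _)).2 ?_
    simp only [Term.rename, Term.rename_up_up]
    exact ((limEq_iff hf hg).1 h).app hH hF ((limEq_iff ha hb).1 h'))
  zero := lim hH hF 0 .zero
  succ := lim hH hF 0 .succ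
  K σ τ := lim hH hF 0 (.K σ τ)
  S ρ σ τ := lim hH hF 0 (.S ρ σ τ)
  R := lim hH hF 0 .R

theorem lim_ap {n : ℕ} {σ ρ : Ty} (f : Term (ctx τ n) (σ ⇢ ρ)) (a : Term (ctx τ n) σ) :
    ap (M := limStruc hH hF) (lim hH hF n f) (lim hH hF n a) = lim hH hF n (f ⬝ a) := by
  refine Quotient.sound ((limEq_iff (le_refl (max n n)) (le_max_left n n)).2 ?_)
  rw [Term.rename_up_self]
  exact .refl hH hF _

/-- The assignment given by a substitution. -/
def limEnv {Δ : Ctx} (n : ℕ) (θ : Sub Δ (ctx τ n)) : Env (limStruc hH hF) Δ :=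
  fun _ x => lim hH hF n (θ _ x)

theorem eval_limEnv {Δ : Ctx} (n : ℕ) (θ : Sub Δ (ctx τ n)) {σ : Ty} (t : Term Δ σ) :
    t.eval (limEnv hH hF n θ) = lim hH hF n (t.subst θ) := by
  induction t with
  | var x => rfl
  | app a b iha ihb => rw [Term.eval, iha, ihb, lim_ap]; rfl
  | zero => exact (lim_up hH hF (Nat.zero_le n) .zero).symm
  | succ => exact (lim_up hH hF (Nat.zero_le n) .succ).symm
  | K => exact (lim_up hH hF (Nat.zero_le n) (.K _ _)).symm
  | S => exact (lim_up hH hF (Nat.zero_le n) (.S _ _ _)).symm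
  | R => exact (lim_up hH hF (Nat.zero_le n) .R).symm

/-- A substitution, extended by a term. -/
def Sub.cons {Γ Δ : Ctx} {σ : Ty} (t : Term Δ σ) (θ : Sub Γ Δ) : Sub (σ :: Γ) Δ
  | _, .z => t
  | _, .s x => θ _ x

theorem limEnv_cons {Δ : Ctx} {n N : ℕ} (h : n ≤ N) (θ : Sub Δ (ctx τ n)) {σ : Ty}
    (t : Term (ctx τ N) σ) :
    limEnv hH hF N (Sub.cons t fun _ x => (θ _ x).rename (up τ h)) =
      Env.cons (M := limStruc hH hF) (lim hH hF N t) (limEnv hH hF n θ) := by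
  funext ρ x
  cases x with
  | z => rfl
  | s x => exact lim_up hH hF h _

/-- The truth lemma. For quantifiers, each element of the model is represented by a term at a stage
that can be taken beyond `n`. -/
theorem sat_limEnv {Δ : Ctx} (ψ : Formula Δ) (n : ℕ) (θ : Sub Δ (ctx τ n)) :
    ψ.Sat (limEnv hH hF n θ) ↔ Holds τ φ H n (ψ.subst θ) := by
  induction ψ generalizing n with
  | eq a b =>
    rw [Sat, eval_limEnv, eval_limEnv]
    exact lim_eq_iff hH hF
  | bot => exact ⟨False.elim, not_holds_bot hH⟩
  | imp ψ χ ih ih' => rw [Sat, ih, ih', Formula.subst, holds_imp hF]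
  | all σ ψ ih =>
    have key : ∀ (N : ℕ) (h : n ≤ N) (t : Term (ctx τ N) σ),
        ((ψ.subst (θ.lift σ)).rename ((up τ h).lift σ)).inst t =
          ψ.subst (Sub.cons t fun _ x => (θ _ x).rename (up τ h)) := by
      intro N h t
      simp only [Formula.inst, rename_eq_subst, subst_subst, Term.rename_eq_subst]
      congr 1
      funext ρ x
      cases x with
      | z => rfl
      | s x =>
        simp only [Sub.lift, Term.wk, Term.rename_eq_subst, Term.subst_subst, Term.subst,
          Sub.cons]
        rfl
    rw [Sat, Formula.subst, holds_all hH hF]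
    constructor
    · intro h N hN t
      rw [key, ← ih, limEnv_cons]
      exact h _
    · intro h c
      obtain ⟨m, t, rfl⟩ := exists_lim hH hF c
      rw [← lim_up hH hF (le_max_right n m), ← limEnv_cons hH hF (le_max_left n m), ih, ← key]
      exact h _ _ _

/-- Contexts are finite, so the elements assigned to them have representatives at a common stage. -/
theorem exists_limEnv {Δ : Ctx} (ρ : Env (limStruc hH hF) Δ) :
    ∃ n θ, ρ = limEnv hH hF n θ := by
  induction Δ with
  | nil => exact ⟨0, fun _ x => .var (Ren.ofEmpty _ x), funext fun _ => funext fun x => by cases x⟩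
  | cons σ Δ ih =>
    obtain ⟨n, θ, h⟩ := ih fun _ x => ρ _ (.s x)
    obtain ⟨m, t, h'⟩ := exists_lim hH hF (ρ _ .z)
    refine ⟨max n m, Sub.cons (t.rename (up τ (le_max_right n m)))
      fun _ x => (θ _ x).rename (up τ (le_max_left n m)), ?_⟩
    rw [limEnv_cons, lim_up, ← h, ← h']
    funext ρ x
    cases x <;> rfl

theorem sat_of_derives {Δ : Ctx} {ψ : Formula Δ} (h : Derives [] ψ) (ρ : Env (limStruc hH hF) Δ) :
    ψ.Sat ρ := by
  obtain ⟨n, θ, rfl⟩ := exists_limEnv hH hF ρ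
  rw [sat_limEnv]
  exact .of_derives (h.subst θ (by simp))

theorem limStruc_ext {σ ρ : Ty} (f g : (limStruc hH hF).C (σ ⇢ ρ))
    (h : ∀ x, f ◇ x = g ◇ x) : f = g := by
  obtain ⟨n, f, rfl⟩ := exists_lim hH hF f
  obtain ⟨m, g, rfl⟩ := exists_lim hH hF g
  rw [← lim_up hH hF (le_max_left n m) f, ← lim_up hH hF (le_max_right n m) g] at h ⊢
  refine (lim_eq_iff hH hF).2 ((hEqT_arrow hH hF).2 ?_)
  intro N hN t
  have := h (lim hH hF N t)
  rw [← lim_up hH hF hN, ← lim_up hH hF hN (g.rename _), lim_ap, lim_ap] at this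
  exact (lim_eq_iff hH hF).1 this

/-- The term model. -/
def limModel : Model where
  toStruc := limStruc hH hF
  ext := limStruc_ext hH hF
  succ_ne_zero a := sat_of_derives hH hF (.ax (.succ_ne_zero v0)) (Env.nil.cons a)
  succ_inj a b := sat_of_derives hH hF (.ax (.succ_inj v1 v0)) ((Env.nil.cons a).cons b)
  K_ap a b := (Formula.sat_eqT (limStruc_ext hH hF) _ _ _).1
    (sat_of_derives hH hF (.ax (.K v1 v0)) ((Env.nil.cons a).cons b))
  S_ap a b c := (Formula.sat_eqT (limStruc_ext hH hF) _ _ _).1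
    (sat_of_derives hH hF (.ax (.S v2 v1 v0)) (((Env.nil.cons a).cons b).cons c))
  R_zero a b := sat_of_derives hH hF (.ax (.R_zero v1 v0)) ((Env.nil.cons a).cons b)
  R_succ a b c := sat_of_derives hH hF (.ax (.R_succ v2 v1 v0))
    (((Env.nil.cons a).cons b).cons c)
  ind ψ hψ ρ h0 hs := by
    have := sat_of_derives hH hF (.ax (.ind ψ hψ)) ρ
    simp only [Formula.and, Formula.neg, Sat] at this
    refine this fun h => h ?_ ?_
    · rw [Formula.inst, sat_subst]
      convert h0 using 1
      funext σ x
      cases x <;> rfl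
    · intro c hc
      rw [sat_subst]
      convert hs c hc using 1
      funext σ x
      cases x <;> rfl
  qfac G h := by
    -- The single instance `G f x = 0` with parameter `G` suffices, because decidable conditions are
    -- later presented by characteristic terms.
    have := sat_of_derives hH hF (.ax (.qfac (v2 ⬝ v1 ⬝ v0 ≐ .zero) (by simp [QF])))
      (Env.nil.cons G)
    simp only [Formula.ex, Formula.neg, Sat, Formula.subst] at this
    by_contra h'
    push Not at h'
    refine this (fun f hf => ?_) fun F hF => ?_
    · obtain ⟨x, hx⟩ := h f
      exact hf x hx
    · obtain ⟨f, hf⟩ := h' F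
      exact hf (hF f)

end TermModel

/-- Completeness: a sentence that is true in all models is provable. -/
theorem provable_of_sat {φ : Formula []} (h : ∀ M : Model, φ.Sat (Env.nil (M := M.toStruc))) :
    Provable φ := by
  by_contra hφ
  have hH : ¬ Derives [neg φ] bot := fun h => hφ (.raa h)
  obtain ⟨τ, χ, hF⟩ := exists_fair
  have h1 : Holds τ χ [neg φ] 0 (neg φ) := .of_derives (.hyp List.mem_cons_self)
  have h2 := (sat_limEnv hH hF (neg φ) 0 fun _ x => .var x).2 
    ((congrArg (Holds τ χ [neg φ] 0) (Formula.subst_var (neg φ))).mpr h1)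
  have h3 : Env.nil = limEnv hH hF 0 (Δ := []) fun _ x => .var x :=
    funext fun _ => funext fun x => by cases x
  refine h2 ?_
  rw [← h3]
  exact h (limModel hH hF)

/-! ### Abstraction -/

/-- Combinatory abstraction of the most recent variable. -/
def Term.lam {Γ : Ctx} {σ : Ty} : {τ : Ty} → Term (σ :: Γ) τ → Term Γ (σ ⇢ τ)
  | _, .var .z => .S σ (σ ⇢ σ) σ ⬝ .K σ (σ ⇢ σ) ⬝ .K σ σ
  | _, .var (.s x) => .K _ _ ⬝ .var x
  | _, .app a b => .S _ _ _ ⬝ a.lam ⬝ b.lam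
  | _, .zero => .K _ _ ⬝ .zero
  | _, .succ => .K _ _ ⬝ .succ
  | _, .K ρ τ => .K _ _ ⬝ .K ρ τ
  | _, .S ρ τ υ => .K _ _ ⬝ .S ρ τ υ
  | _, .R => .K _ _ ⬝ .R

attribute [simp] Term.eval Env.cons Model.K_ap Model.S_ap

section

variable {M : Model} {Γ : Ctx}

-- The β-rule is needed only for values in a model, where it follows from the equations for `K` and
-- `S`.
@[simp] theorem Term.eval_lam (ρ : Env M.toStruc Γ) {σ τ : Ty} (t : Term (σ :: Γ) τ) (c : M.C σ) :
    t.lam.eval ρ ◇ c = t.eval (ρ.cons c) := by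
  induction t with
  | var x => cases x <;> simp [Term.lam]
  | _ => simp [Term.lam, *]

@[simp] theorem Term.eval_ofClosed {M : Struc} (ρ : Env M Γ) {σ : Ty} (t : Term [] σ) :
    t.ofClosed.eval ρ = t.eval Env.nil := by
  rw [Term.ofClosed, Term.eval_rename]
  congr 1
  funext σ x
  cases x

/-! ### Arithmetic in a model -/

/-- The numbers of a model. -/
abbrev Model.N (M : Model) : Type := M.C Ty.nat

instance : Zero M.N := ⟨M.zero⟩
instance : One M.N := ⟨M.succ ◇ M.zero⟩
instance : Add M.N := ⟨fun a b => (add : Term [] _).eval Env.nil ◇ a ◇ b⟩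

@[simp] theorem Model.zero_eq : M.zero = (0 : M.N) := rfl

@[simp] theorem eval_add (ρ : Env M.toStruc Γ) (a b : M.N) :
    (add : Term Γ _).eval ρ ◇ a ◇ b = a + b := rfl

theorem eval_add_nil (a b : M.N) :
    (add : Term [] _).eval Env.nil ◇ a ◇ b = a + b := rfl

theorem Model.add_zero' (a : M.N) : a + 0 = a := by
  rw [← eval_add_nil]
  simp [add, ← Model.zero_eq, Model.R_zero]

theorem Model.add_succ' (a b : M.N) : a + M.succ ◇ b = M.succ ◇ (a + b) := by
  rw [← eval_add_nil, ← eval_add_nil]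
  simp [add, succFst, Model.R_succ]

@[simp] theorem Model.succ_eq (a : M.N) : M.succ ◇ a = a + 1 := by
  rw [show (1 : M.N) = M.succ ◇ 0 from rfl, Model.add_succ', Model.add_zero']

@[simp] theorem Model.R_zero' (a : M.N) (b : M.C (Ty.nat ⇢ Ty.nat ⇢ Ty.nat)) :
    M.R ◇ a ◇ b ◇ 0 = a := M.R_zero _ _

@[simp] theorem Model.R_succ' (a : M.N) (b : M.C (Ty.nat ⇢ Ty.nat ⇢ Ty.nat)) (c : M.N) :
    M.R ◇ a ◇ b ◇ (c + 1) = b ◇ (M.R ◇ a ◇ b ◇ c) ◇ c := by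
  rw [← Model.succ_eq, M.R_succ]

theorem Model.add_one_ne_zero (a : M.N) : a + 1 ≠ 0 := by
  rw [← Model.succ_eq]
  exact M.succ_ne_zero a

theorem Model.add_one_inj' {a b : M.N} (h : a + 1 = b + 1) : a = b := by
  rw [← Model.succ_eq, ← Model.succ_eq] at h
  exact M.succ_inj a b h

theorem Model.ind_sat (ρ : Env M.toStruc Γ) (φ : Formula (Ty.nat :: Γ)) (hφ : φ.QF)
    (h0 : φ.Sat (ρ.cons (0 : M.N))) (hs : ∀ c : M.N, φ.Sat (ρ.cons c) → φ.Sat (ρ.cons (c + 1)))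
    (c : M.N) : φ.Sat (ρ.cons c) :=
  M.ind φ hφ ρ h0 (fun c hc => by rw [Model.succ_eq]; exact hs c hc) c

theorem Model.ind_eq (ρ : Env M.toStruc Γ) (s t : Term (Ty.nat :: Γ) Ty.nat)
    (h0 : s.eval (ρ.cons (0 : M.N)) = t.eval (ρ.cons (0 : M.N)))
    (hs : ∀ c : M.N, s.eval (ρ.cons c) = t.eval (ρ.cons c) →
      s.eval (ρ.cons (c + 1)) = t.eval (ρ.cons (c + 1))) (c : M.N) :
    s.eval (ρ.cons c) = t.eval (ρ.cons c) :=
  Model.ind_sat ρ (s ≐ t) (by simp [QF]) h0 hs c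

theorem Model.add_assoc' (a b c : M.N) : a + b + c = a + (b + c) := by
  have := Model.ind_eq ((Env.nil.cons a).cons b) (add ⬝ (add ⬝ v2 ⬝ v1) ⬝ v0)
    (add ⬝ v2 ⬝ (add ⬝ v1 ⬝ v0)) (by simp [Model.add_zero']) (fun c h => ?_) c
  · simpa using this
  · simp only [Term.eval, Env.cons, eval_add] at h ⊢
    rw [← Model.succ_eq, Model.add_succ', Model.add_succ', Model.add_succ', h]

theorem Model.zero_add' (a : M.N) : 0 + a = a := by
  have := Model.ind_eq Env.nil (add ⬝ .zero ⬝ v0) v0 (by simp [Model.add_zero']) (fun c h => ?_) a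
  · simpa using this
  · simp only [Term.eval, Env.cons, eval_add, Model.zero_eq] at h ⊢
    rw [← Model.add_assoc', h]

theorem Model.one_add' (a : M.N) : 1 + a = a + 1 := by
  have := Model.ind_eq Env.nil (add ⬝ (.succ ⬝ .zero) ⬝ v0) (add ⬝ v0 ⬝ (.succ ⬝ .zero))
    (by simp [Model.add_zero', Model.zero_add']) (fun c h => ?_) a
  · simpa [Model.zero_add'] using this
  · simp only [Term.eval, Env.cons, eval_add, Model.zero_eq, Model.succ_eq,
      Model.zero_add'] at h ⊢
    rw [← Model.add_assoc', h]

theorem Model.add_comm' (a b : M.N) : a + b = b + a := by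
  have := Model.ind_eq (Env.nil.cons a) (add ⬝ v1 ⬝ v0) (add ⬝ v0 ⬝ v1)
    (by simp [Model.add_zero', Model.zero_add']) (fun c h => ?_) b
  · simpa using this
  · simp only [Term.eval, Env.cons, eval_add] at h ⊢
    rw [← Model.add_assoc', h, Model.add_assoc', Model.add_assoc', Model.one_add']

instance : AddCommMonoid M.N where
  add_assoc := Model.add_assoc'
  zero_add := Model.zero_add'
  add_zero := Model.add_zero'
  add_comm := Model.add_comm'
  nsmul := nsmulRec

/-- The predecessor function. -/
def predT : Term [] Ty.one := .R ⬝ .zero ⬝ .lam (.lam v0)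

/-- Truncated subtraction. -/
def subT : Term [] (Ty.nat ⇢ Ty.nat ⇢ Ty.nat) :=
  .lam (.R ⬝ v0 ⬝ .lam (.lam (predT.ofClosed ⬝ v1)))

instance : _root_.Sub M.N := ⟨fun a b => subT.eval Env.nil ◇ a ◇ b⟩

/-- The predecessor of a number of a model. -/
def Model.pred (a : M.N) : M.N := predT.eval Env.nil ◇ a

def tSub (a b : Term Γ Ty.nat) : Term Γ Ty.nat := subT.ofClosed ⬝ a ⬝ b

@[simp] theorem eval_tSub (ρ : Env M.toStruc Γ) (a b : Term Γ Ty.nat) :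
    (tSub a b).eval ρ = a.eval ρ - b.eval ρ := by
  simp only [tSub, Term.eval, Term.eval_ofClosed]
  rfl

theorem Model.pred_zero : Model.pred (0 : M.N) = 0 := by simp [Model.pred, predT]

theorem Model.pred_add_one (a : M.N) : Model.pred (a + 1) = a := by
  simp [Model.pred, predT]

theorem Model.sub_zero' (a : M.N) : a - 0 = a := by
  change subT.eval Env.nil ◇ a ◇ 0 = a
  simp [subT]

theorem Model.sub_add_one (a b : M.N) : a - (b + 1) = Model.pred (a - b) := by
  change subT.eval Env.nil ◇ a ◇ (b + 1) = predT.eval Env.nil ◇ (subT.eval Env.nil ◇ a ◇ b)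
  simp [subT]

theorem Model.add_one_sub_add_one (a b : M.N) : (a + 1) - (b + 1) = a - b := by
  have := Model.ind_eq (Env.nil.cons a) (tSub (.succ ⬝ v1) (.succ ⬝ v0)) (tSub v1 v0)
    (by
      have := Model.sub_add_one (a + 1) 0
      rw [zero_add, Model.sub_zero', Model.pred_add_one] at this
      simpa [Model.sub_zero'] using this) (fun c h => ?_) b
  · simpa using this
  · simp only [Term.eval, Env.cons, eval_tSub, Model.succ_eq] at h ⊢
    rw [Model.sub_add_one, h, ← Model.sub_add_one]

theorem Model.add_sub_cancel_right' (a b : M.N) : a + b - b = a := by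
  have := Model.ind_eq (Env.nil.cons a) (tSub (add ⬝ v1 ⬝ v0) v0) v1
    (by simp [Model.sub_zero']) (fun c h => ?_) b
  · simpa using this
  · simp only [Term.eval, Env.cons, eval_tSub, eval_add] at h ⊢
    rw [← add_assoc, Model.add_one_sub_add_one, h]

theorem Model.eq_zero_or (a : M.N) : a = 0 ∨ ∃ b, a = b + 1 := by
  have := Model.ind_sat (Env.nil (M := M.toStruc))
    (neg (v0 ≐ .zero) ⇾ v0 ≐ .succ ⬝ (predT.ofClosed ⬝ v0))
    (by simp [QF, Formula.neg]) (by simp [Sat, Formula.neg])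
    (fun c _ => by
      simp only [Sat, Term.eval, Env.cons, Term.eval_ofClosed, Model.succ_eq]
      intro _
      exact congrArg (· + 1) (Model.pred_add_one c).symm) a
  simp only [Sat, Formula.neg, Term.eval, Env.cons, Term.eval_ofClosed, Model.succ_eq] at this
  by_cases h : a = 0
  · exact .inl h
  · exact .inr ⟨_, this h⟩

theorem Model.add_right_cancel' {a b c : M.N} (h : a + c = b + c) : a = b := by
  rw [← Model.add_sub_cancel_right' a c, h, Model.add_sub_cancel_right']

theorem Model.eq_zero_of_add {a b : M.N} (h : a + b = 0) : a = 0 := by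
  rcases Model.eq_zero_or b with rfl | ⟨c, rfl⟩
  · rwa [add_zero] at h
  · rw [← add_assoc] at h
    exact absurd h (Model.add_one_ne_zero _)

/-- Truncated subtraction provides the witnesses, which turns the dichotomy into a quantifier-free
statement open to induction. -/
theorem Model.exists_add (a b : M.N) : (∃ c, a + c = b) ∨ ∃ c, b + c = a := by
  have := Model.ind_sat (Env.nil.cons a)
    (neg (add ⬝ v1 ⬝ (tSub v0 v1) ≐ v0) ⇾ add ⬝ v0 ⬝ (tSub v1 v0) ≐ v1)
    (by simp [QF, Formula.neg])
    (by simp [Sat, Formula.neg, Model.sub_zero'])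
    (fun c h => by
      simp only [Sat, Formula.neg, Term.eval, Env.cons, eval_add, eval_tSub] at h ⊢
      intro h'
      by_cases h1 : a + (c - a) = c
      · refine (h' ?_).elim
        generalize c - a = d at h1
        subst h1
        rw [add_assoc, add_comm a (d + 1), Model.add_sub_cancel_right', add_comm]
      · have h2 := h h1
        rcases Model.eq_zero_or (a - c) with h3 | ⟨d, h3⟩
        · rw [h3, add_zero] at h2
          subst h2
          rw [add_comm c 1, Model.add_sub_cancel_right'] at h'
          exact (h' (add_comm _ _)).elim
        · rw [Model.sub_add_one, h3, Model.pred_add_one, ← h2, h3, add_assoc, add_comm 1]) b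
  simp only [Sat, Formula.neg, Term.eval, Env.cons, eval_add, eval_tSub] at this
  by_cases h : a + (b - a) = b
  · exact .inl ⟨_, h⟩
  · exact .inr ⟨_, this h⟩

instance : LE M.N := ⟨fun a b => ∃ c, a + c = b⟩

noncomputable instance : LinearOrder M.N where
  le_refl a := ⟨0, add_zero a⟩
  le_trans := by
    rintro a _ _ ⟨c, rfl⟩ ⟨d, rfl⟩
    exact ⟨c + d, (add_assoc _ _ _).symm⟩
  le_antisymm := by
    rintro a b ⟨c, rfl⟩ ⟨d, h⟩
    have h1 : (c + d) + a = 0 + a := by rw [zero_add, add_comm, ← add_assoc, h]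
    rw [Model.eq_zero_of_add (Model.add_right_cancel' h1), add_zero]
  le_total := Model.exists_add
  toDecidableLE := Classical.decRel _

instance : CanonicallyOrderedAdd M.N where
  exists_add_of_le := fun ⟨c, h⟩ => ⟨c, h.symm⟩
  le_add_self _ b := ⟨b, add_comm _ _⟩
  le_self_add _ b := ⟨b, rfl⟩

instance : IsOrderedCancelAddMonoid M.N where
  add_le_add_left := by
    rintro a _ ⟨c, rfl⟩ b
    exact ⟨c, add_right_comm _ _ _⟩
  le_of_add_le_add_left := by
    rintro a b c ⟨d, h⟩
    refine ⟨d, Model.add_right_cancel' (c := a) ?_⟩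
    rw [← add_comm a c, ← h, add_comm, add_assoc]

theorem Model.add_one_le_iff {a b : M.N} : a + 1 ≤ b ↔ a < b := by
  constructor
  · intro h
    refine lt_of_le_of_ne (le_self_add.trans h) ?_
    rintro rfl
    obtain ⟨c, hc⟩ := h
    have h1 : (1 + c) + a = 0 + a := by rw [zero_add, add_comm, ← add_assoc, hc]
    have := Model.eq_zero_of_add (Model.add_right_cancel' h1)
    exact Model.add_one_ne_zero (0 : M.N) (by rw [zero_add, this])
  · intro h
    obtain ⟨c, rfl⟩ := h.le
    rcases Model.eq_zero_or c with rfl | ⟨d, rfl⟩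
    · simp at h
    · exact ⟨d, by rw [add_assoc, add_comm 1]⟩

theorem Model.lt_add_one_iff {a b : M.N} : a < b + 1 ↔ a ≤ b := by
  rw [← Model.add_one_le_iff, add_le_add_iff_right]

theorem Model.lt_add_one (a : M.N) : a < a + 1 := Model.lt_add_one_iff.2 le_rfl

theorem Model.sub_eq_zero_iff {a b : M.N} : a - b = 0 ↔ a ≤ b := by
  constructor
  · intro h
    rcases le_total a b with h' | ⟨c, rfl⟩
    · exact h'
    · rw [add_comm, Model.add_sub_cancel_right'] at h
      rw [h, add_zero]
  · rintro ⟨c, rfl⟩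
    have := Model.ind_eq ((Env.nil.cons a).cons c) (tSub v0 (add ⬝ v0 ⬝ v1)) .zero
      (by
        have := Model.ind_eq Env.nil (tSub .zero v0) .zero (by simp [Model.sub_zero'])
          (fun d h => by
            simp only [Term.eval, Env.cons, eval_tSub, Model.zero_eq] at h ⊢
            rw [Model.sub_add_one, h, Model.pred_zero]) c
        simpa using this)
      (fun d h => by
        simp only [Term.eval, Env.cons, eval_tSub, Model.zero_eq, eval_add] at h ⊢
        rw [add_right_comm, Model.add_one_sub_add_one, h]) a
    simpa using this

instance : NeZero (1 : M.N) := ⟨by simpa using Model.add_one_ne_zero (0 : M.N)⟩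


end

/-! ### Characteristic terms: a term of type `0` is read as true if its value is `0` -/

section

variable {M : Model} {Γ : Ctx}

/-- `if c = 0 then a else b`. -/
def tIte (c a b : Term Γ Ty.nat) : Term Γ Ty.nat := .R ⬝ a ⬝ (.K _ _ ⬝ (.K _ _ ⬝ b)) ⬝ c
def tEq (a b : Term Γ Ty.nat) : Term Γ Ty.nat := add ⬝ tSub a b ⬝ tSub b a
def tLt (a b : Term Γ Ty.nat) : Term Γ Ty.nat := tSub (.succ ⬝ a) b
def tNot (a : Term Γ Ty.nat) : Term Γ Ty.nat := tIte a numOne .zero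
def tAnd (a b : Term Γ Ty.nat) : Term Γ Ty.nat := add ⬝ a ⬝ b
def tImp (a b : Term Γ Ty.nat) : Term Γ Ty.nat := tIte a b .zero

@[simp] theorem eval_numOne (ρ : Env M.toStruc Γ) : (numOne : Term Γ Ty.nat).eval ρ = (1 : M.N) :=
  rfl

open Classical in
@[simp] theorem eval_tIte (ρ : Env M.toStruc Γ) (c a b : Term Γ Ty.nat) :
    (tIte c a b).eval ρ = if c.eval ρ = (0 : M.N) then a.eval ρ else b.eval ρ := by
  rcases Model.eq_zero_or (c.eval ρ) with h | ⟨d, h⟩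
  · simp [tIte, h]
  · simp [tIte, h]

@[simp] theorem eval_tEq (ρ : Env M.toStruc Γ) (a b : Term Γ Ty.nat) :
    (tEq a b).eval ρ = (0 : M.N) ↔ (a.eval ρ : M.N) = b.eval ρ := by
  simp only [tEq, Term.eval, eval_add, eval_tSub, add_eq_zero, Model.sub_eq_zero_iff]
  exact antisymm_iff

@[simp] theorem sub_eq_zero' {a b : M.N} : a - b = 0 ↔ a ≤ b := Model.sub_eq_zero_iff

@[simp] theorem eval_tLt (ρ : Env M.toStruc Γ) (a b : Term Γ Ty.nat) :
    (tLt a b).eval ρ = (0 : M.N) ↔ (a.eval ρ : M.N) < b.eval ρ := by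
  simp [tLt, Model.add_one_le_iff]

@[simp] theorem eval_tNot (ρ : Env M.toStruc Γ) (a : Term Γ Ty.nat) :
    (tNot a).eval ρ = (0 : M.N) ↔ (a.eval ρ : M.N) ≠ 0 := by
  simp [tNot]

@[simp] theorem eval_tAnd (ρ : Env M.toStruc Γ) (a b : Term Γ Ty.nat) :
    (tAnd a b).eval ρ = (0 : M.N) ↔ (a.eval ρ : M.N) = 0 ∧ (b.eval ρ : M.N) = 0 := by
  simp [tAnd]

@[simp] theorem eval_tImp (ρ : Env M.toStruc Γ) (a b : Term Γ Ty.nat) :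
    (tImp a b).eval ρ = (0 : M.N) ↔ ((a.eval ρ : M.N) = 0 → (b.eval ρ : M.N) = 0) := by
  simp [tImp]

/-- `P` has a characteristic function in the model. -/
def Dec (P : M.N → Prop) : Prop := ∃ χ : M.C Ty.one, ∀ x : M.N, χ ◇ x = (0 : M.N) ↔ P x

theorem Dec.of {P : M.N → Prop} (ρ : Env M.toStruc Γ) (t : Term (Ty.nat :: Γ) Ty.nat)
    (h : ∀ x : M.N, t.eval (ρ.cons x) = (0 : M.N) ↔ P x) : Dec P :=
  ⟨t.lam.eval ρ, fun x => by rw [Term.eval_lam, h]⟩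

/-- The form of induction used from here on: any quantifier in `P` must be absorbed into a
characteristic function of the model. -/
theorem Dec.induction {P : M.N → Prop} (hP : Dec P) (h0 : P 0) (hs : ∀ x, P x → P (x + 1))
    (x : M.N) : P x := by
  obtain ⟨χ, hχ⟩ := hP
  simp only [← hχ] at h0 hs ⊢
  exact Model.ind_eq (Env.nil.cons χ) (v1 ⬝ v0) .zero h0 hs x

/-! ### Bounded search -/

/-- `f, n ↦` the least zero of `f` that is at most `n`, if there is one. -/
def lzT : Term [] (Ty.one ⇢ Ty.one) :=
  .lam (.R ⬝ .zero ⬝ .lam (.lam (tIte (v2 ⬝ v1) v1 (.succ ⬝ v0))))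

def lz (f : M.C Ty.one) (n : M.N) : M.N := lzT.eval Env.nil ◇ f ◇ n

def tLz (f : Term Γ Ty.one) (n : Term Γ Ty.nat) : Term Γ Ty.nat := lzT.ofClosed ⬝ f ⬝ n

@[simp] theorem eval_tLz (ρ : Env M.toStruc Γ) (f : Term Γ Ty.one) (n : Term Γ Ty.nat) :
    (tLz f n).eval ρ = lz (f.eval ρ) (n.eval ρ) := by
  simp only [tLz, Term.eval, Term.eval_ofClosed]
  rfl

theorem lz_zero (f : M.C Ty.one) : lz f 0 = 0 := by simp [lz, lzT]

open Classical in
theorem lz_add_one (f : M.C Ty.one) (n : M.N) :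
    lz f (n + 1) = if f ◇ (lz f n) = (0 : M.N) then lz f n else n + 1 := by
  simp [lz, lzT]

theorem lz_le (f : M.C Ty.one) (n : M.N) : lz f n ≤ n := by
  refine Dec.induction (P := fun n => lz f n ≤ n)
    (.of (Env.nil.cons f) (tSub (tLz v1 v0) v0) (by simp)) (by simp [lz_zero]) ?_ n
  intro n hn
  rw [lz_add_one]
  split_ifs
  · exact hn.trans le_self_add
  · exact le_rfl

theorem lz_spec {f : M.C Ty.one} {i n : M.N} (hi : i ≤ n) (hf : f ◇ i = (0 : M.N)) :
    f ◇ lz f n = (0 : M.N) ∧ lz f n ≤ i := by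
  revert hi
  refine Dec.induction (P := fun n => i ≤ n → f ◇ lz f n = (0 : M.N) ∧ lz f n ≤ i)
    (.of ((Env.nil.cons f).cons i) (tImp (tSub v1 v0)
      (tAnd (v2 ⬝ tLz v2 v0) (tSub (tLz v2 v0) v1))) (by simp)) ?_ ?_ n
  · intro h
    obtain rfl : i = 0 := by simpa using h
    rw [lz_zero]
    exact ⟨hf, le_rfl⟩
  · intro n ih h
    rw [lz_add_one]
    rcases h.lt_or_eq with h | rfl
    · have := ih (Model.lt_add_one_iff.1 h)
      simpa [this.1] using this.2
    · split_ifs with h'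
      · exact ⟨h', (lz_le f n).trans le_self_add⟩
      · exact ⟨hf, le_rfl⟩

theorem lz_eq {f : M.C Ty.one} {i n : M.N} (hi : i ≤ n) (hf : f ◇ i = (0 : M.N))
    (h : ∀ j < i, f ◇ j ≠ (0 : M.N)) : lz f n = i := by
  obtain ⟨h1, h2⟩ := lz_spec hi hf
  exact le_antisymm h2 (not_lt.1 fun h' => h _ h' h1)

theorem Dec.exists_least {P : M.N → Prop} (hP : Dec P) (h : ∃ x, P x) :
    ∃ x, P x ∧ ∀ y < x, ¬ P y := by
  obtain ⟨χ, hχ⟩ := hP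
  simp only [← hχ] at h ⊢
  obtain ⟨x, hx⟩ := h
  refine ⟨lz χ x, (lz_spec le_rfl hx).1, fun y hy hy' => ?_⟩
  have := (lz_spec (hy.le.trans (lz_le χ x)) hy').2
  exact absurd hy (not_lt.2 this)

/-- Bounded existential quantification: `∃ i ≤ n, b i`. -/
def tBex (n : Term Γ Ty.nat) (b : Term (Ty.nat :: Γ) Ty.nat) : Term Γ Ty.nat :=
  b.lam ⬝ tLz b.lam n

/-- Bounded universal quantification: `∀ i ≤ n, b i`. -/
def tBall (n : Term Γ Ty.nat) (b : Term (Ty.nat :: Γ) Ty.nat) : Term Γ Ty.nat :=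
  tNot (tBex n (tNot b))

-- The bounded search always returns a number at most `n`, and returns a solution whenever there is
-- one; testing the returned number decides the quantifier.
@[simp] theorem eval_tBex (ρ : Env M.toStruc Γ) (n : Term Γ Ty.nat)
    (b : Term (Ty.nat :: Γ) Ty.nat) :
    (tBex n b).eval ρ = (0 : M.N) ↔
      ∃ i : M.N, i ≤ (n.eval ρ : M.N) ∧ b.eval (ρ.cons i) = (0 : M.N) := by
  rw [tBex, Term.eval, eval_tLz]
  constructor
  · intro h
    exact ⟨_, lz_le _ _, by rwa [Term.eval_lam] at h⟩
  · rintro ⟨i, hi, h⟩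
    exact (lz_spec hi (by rwa [Term.eval_lam])).1

@[simp] theorem eval_tBall (ρ : Env M.toStruc Γ) (n : Term Γ Ty.nat)
    (b : Term (Ty.nat :: Γ) Ty.nat) :
    (tBall n b).eval ρ = (0 : M.N) ↔
      ∀ i : M.N, i ≤ (n.eval ρ : M.N) → b.eval (ρ.cons i) = (0 : M.N) := by
  simp [tBall]

/-! ### Pairs -/

/-- The function `l ↦ 0 + 1 + ⋯ + (l - 1)` of the model. -/
def Model.tri (l : M.N) : M.N := (RCAomega.tri : Term [] _).eval Env.nil ◇ l

@[simp] theorem eval_tri (ρ : Env M.toStruc Γ) (l : M.N) :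
    (tri : Term Γ _).eval ρ ◇ l = Model.tri l := rfl

theorem Model.tri_add_one (l : M.N) : Model.tri (l + 1) = Model.tri l + l := by
  simp [Model.tri, RCAomega.tri]

/-- The code of the pair `{k, l}` with `k < l`. -/
def pc (k l : M.N) : M.N := Model.tri l + k

@[simp] theorem eval_pairCode (ρ : Env M.toStruc Γ) (k l : Term Γ Ty.nat) :
    (pairCode k l).eval ρ = pc (k.eval ρ : M.N) (l.eval ρ) := by
  simp [pairCode, pc]

theorem Model.tri_mono {a b : M.N} (h : a ≤ b) : Model.tri a ≤ Model.tri b := by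
  obtain ⟨d, rfl⟩ := h
  refine Dec.induction (P := fun d => Model.tri a ≤ Model.tri (a + d))
    (.of (Env.nil.cons a) (tSub (.app RCAomega.tri v1) (.app RCAomega.tri (add ⬝ v1 ⬝ v0)))
      (by simp)) (by simp) ?_ d
  intro d hd
  rw [← add_assoc, Model.tri_add_one]
  exact hd.trans le_self_add

theorem pc_lt_tri {k l : M.N} (h : k < l) : pc k l < Model.tri (l + 1) := by
  rw [pc, Model.tri_add_one]
  exact add_lt_add_right h _

theorem tri_le_pc (k l : M.N) : Model.tri l ≤ pc k l := le_self_add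

theorem le_pc {k l m : M.N} (h : m < l) : m ≤ pc k l := by
  refine le_trans ?_ (tri_le_pc k l)
  refine le_trans ?_ (Model.tri_mono (Model.add_one_le_iff.2 h))
  rw [Model.tri_add_one]
  exact le_add_self

/-- The codes of pairs with larger element `l` lie between `tri l` and `tri (l + 1)`, and these
intervals are disjoint for different `l`. -/
theorem pc_inj {k l k' l' : M.N} (h : k < l) (h' : k' < l') (e : pc k l = pc k' l') :
    k = k' ∧ l = l' := by
  obtain rfl : l = l' := by
    rcases lt_trichotomy l l' with h1 | h1 | h1
    · have := (pc_lt_tri h).trans_le ((Model.tri_mono (Model.add_one_le_iff.2 h1)).trans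
        (tri_le_pc k' l'))
      exact absurd e this.ne
    · exact h1
    · have := (pc_lt_tri h').trans_le ((Model.tri_mono (Model.add_one_le_iff.2 h1)).trans
        (tri_le_pc k l))
      exact absurd e.symm this.ne
  exact ⟨add_left_cancel e, rfl⟩

/-- The code of the ordered pair of `a` and `b`. -/
def pair (a b : M.N) : M.N := pc a (a + b + 1)

def tPair (a b : Term Γ Ty.nat) : Term Γ Ty.nat := pairCode a (.succ ⬝ (add ⬝ a ⬝ b))

@[simp] theorem eval_tPair (ρ : Env M.toStruc Γ) (a b : Term Γ Ty.nat) :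
    (tPair a b).eval ρ = pair (a.eval ρ : M.N) (b.eval ρ) := by
  simp [tPair, pair]

/-- As `a < a + b + 1`, an ordered pair is coded by an unordered one, and `pc_inj` applies. -/
theorem pair_inj {a b a' b' : M.N} (h : pair a b = pair a' b') : a = a' ∧ b = b' := by
  obtain ⟨rfl, h⟩ := pc_inj (Model.lt_add_one_iff.2 le_self_add)
    (Model.lt_add_one_iff.2 le_self_add) h
  exact ⟨rfl, add_left_cancel (Model.add_one_inj' h)⟩

theorem left_le_pair (a b : M.N) : a ≤ pair a b := le_pc (Model.lt_add_one_iff.2 le_self_add)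

theorem right_le_pair (a b : M.N) : b ≤ pair a b := le_pc (Model.lt_add_one_iff.2 le_add_self)

/-- The first component of an ordered pair. -/
def fstT : Term [] Ty.one := .lam (tLz (.lam (tBex v1 (tEq (tPair v1 v0) v2))) v0)

/-- The second component of an ordered pair. -/
def sndT : Term [] Ty.one := .lam (tLz (.lam (tBex v1 (tEq (tPair v0 v1) v2))) v0)

def fst (z : M.N) : M.N := fstT.eval Env.nil ◇ z

def snd (z : M.N) : M.N := sndT.eval Env.nil ◇ z

def tFst (a : Term Γ Ty.nat) : Term Γ Ty.nat := fstT.ofClosed ⬝ a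

def tSnd (a : Term Γ Ty.nat) : Term Γ Ty.nat := sndT.ofClosed ⬝ a

@[simp] theorem eval_tFst (ρ : Env M.toStruc Γ) (a : Term Γ Ty.nat) :
    (tFst a).eval ρ = fst (a.eval ρ : M.N) := by
  simp only [tFst, Term.eval, Term.eval_ofClosed]
  rfl

@[simp] theorem eval_tSnd (ρ : Env M.toStruc Γ) (a : Term Γ Ty.nat) :
    (tSnd a).eval ρ = snd (a.eval ρ : M.N) := by
  simp only [tSnd, Term.eval, Term.eval_ofClosed]
  rfl

@[simp] theorem fst_pair (a b : M.N) : fst (pair a b) = a := by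
  simp only [fst, fstT, Term.eval_lam, eval_tLz]
  refine lz_eq (left_le_pair a b) ?_ ?_
  · simpa using ⟨b, right_le_pair a b, rfl⟩
  · intro j hj
    simp only [Term.eval_lam, eval_tBex, eval_tEq, eval_tPair, Term.eval, Env.cons, ne_eq]
    rintro ⟨i, _, h⟩
    exact hj.ne (pair_inj h).1

@[simp] theorem snd_pair (a b : M.N) : snd (pair a b) = b := by
  simp only [snd, sndT, Term.eval_lam, eval_tLz]
  refine lz_eq (right_le_pair a b) ?_ ?_
  · simpa using ⟨a, left_le_pair a b, rfl⟩
  · intro j hj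
    simp only [Term.eval_lam, eval_tBex, eval_tEq, eval_tPair, Term.eval, Env.cons, ne_eq]
    rintro ⟨i, _, h⟩
    exact hj.ne (pair_inj h).2

/-! ### Course-of-values recursion -/

/-- `c, x, y ↦` the entry `y` of the sequence of length `x` with the code `c`. -/
def decodeT : Term [] (Ty.nat ⇢ Ty.nat ⇢ Ty.one) :=
  .lam (.lam (.lam (tIte (tLt v0 v1)
    (tSnd (.R ⬝ v2 ⬝ (.ofClosed (.lam (.lam (tFst v1)))) ⬝ tSub v1 (.succ ⬝ v0))) .zero)))

/-- `Φ, x ↦` the code of the first `x` values of the function defined from `Φ`. -/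
def codeT : Term [] ((Ty.one ⇢ Ty.one) ⇢ Ty.one) :=
  .lam (.R ⬝ .zero ⬝ .lam (.lam (tPair v1 (v2 ⬝ (decodeT.ofClosed ⬝ v1 ⬝ v0) ⬝ v0))))

/-- `Φ ↦` the function `D` with `D x = Φ (D ↾ x) x`. -/
def covT : Term [] ((Ty.one ⇢ Ty.one) ⇢ Ty.one) :=
  .lam (.lam (tSnd (codeT.ofClosed ⬝ v1 ⬝ (.succ ⬝ v0))))

def cov (Φ : M.C (Ty.one ⇢ Ty.one)) : M.C Ty.one := covT.eval Env.nil ◇ Φ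

/-- Only the recursor of type 0 is available, so the history is carried along as a number of nested
pairs and decoded to a function `h`, extended by 0, before `Φ` is applied to it. -/
theorem cov_spec (Φ : M.C (Ty.one ⇢ Ty.one)) (x : M.N) :
    ∃ h : M.C Ty.one, (∀ y < x, h ◇ y = cov Φ ◇ y) ∧ (∀ y : M.N, x ≤ y → h ◇ y = (0 : M.N)) ∧
      cov Φ ◇ x = Φ ◇ h ◇ x := by
  let c : M.N → M.N := fun x => codeT.eval Env.nil ◇ Φ ◇ x
  have hc (x : M.N) : c (x + 1) = pair (c x) (Φ ◇ (decodeT.eval Env.nil ◇ c x ◇ x) ◇ x) := by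
    simp only [c]
    conv_lhs => simp [codeT]
    simp [codeT]
  have hcov (x : M.N) : cov Φ ◇ x = snd (c (x + 1)) := by simp [cov, covT, c]
  let it : M.N → M.N → M.N := fun a j =>
    M.R ◇ a ◇ (Term.lam (.lam (tFst v1)) : Term [] _).eval Env.nil ◇ j
  -- Stripping `j` outer pairs from the code of length `x` leaves the code of length `x - j`; the
  -- entry `y` is then the second component at length `y + 1`.
  have hit (x j : M.N) : j ≤ x → it (c x) j = c (x - j) := by
    refine Dec.induction (P := fun j => j ≤ x → it (c x) j = c (x - j))
      (.of ((Env.nil.cons x).cons Φ) (tImp (tSub v0 v2)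
        (tEq (.R ⬝ (codeT.ofClosed ⬝ v1 ⬝ v2) ⬝ (.ofClosed (.lam (.lam (tFst v1)))) ⬝ v0)
          (codeT.ofClosed ⬝ v1 ⬝ (tSub v2 v0)))) (by simp [it, c])) ?_ ?_ j
    · intro _
      simp [it, Model.sub_zero']
    · rintro j ih ⟨d, rfl⟩
      have h1 : j + 1 + d - (j + 1) = d := by
        rw [add_comm, Model.add_sub_cancel_right']
      have h2 : j + 1 + d - j = d + 1 := by
        rw [add_assoc, add_comm 1, add_comm, Model.add_sub_cancel_right']
      have h3 := ih (by rw [add_assoc]; exact le_self_add)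
      rw [h2, hc] at h3
      rw [h1]
      have h4 : it (c (j + 1 + d)) (j + 1) = fst (it (c (j + 1 + d)) j) := by
        simp [it]
      rw [h4, h3, fst_pair]
  refine ⟨decodeT.eval Env.nil ◇ c x ◇ x, fun y hy => ?_, fun y hy => ?_, ?_⟩
  · have h1 := Model.add_one_le_iff.2 hy
    obtain ⟨d, rfl⟩ := h1
    have h2 := hit (y + 1 + d) d le_add_self
    rw [Model.add_sub_cancel_right'] at h2
    rw [hcov, ← h2]
    have h3 : y + 1 + d - (y + 1) = d := by
      rw [add_comm, Model.add_sub_cancel_right']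
    have h4 : y < y + 1 + d := hy
    simp [decodeT, h3, h4, it]
  · simp [decodeT, not_lt.2 hy]
  · rw [hcov, hc, snd_pair]

end

section

variable {M : Model} {Γ : Ctx}

abbrev v3 {σ τ ρ υ : Ty} : Term (υ :: ρ :: τ :: σ :: Γ) σ := .var (.s (.s (.s .z)))
abbrev v4 {σ τ ρ υ φ : Ty} : Term (φ :: υ :: ρ :: τ :: σ :: Γ) σ := .var (.s (.s (.s (.s .z))))
abbrev v5 {σ τ ρ υ φ χ : Ty} : Term (χ :: φ :: υ :: ρ :: τ :: σ :: Γ) σ :=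
  .var (.s (.s (.s (.s (.s .z)))))

/-! ### Unbounded search -/

/-- `μ` is Feferman's search operator. -/
def IsMu (μ : M.C Ty.two) : Prop :=
  ∀ f : M.C Ty.one, (∃ n : M.N, f ◇ n = (0 : M.N)) → f ◇ (μ ◇ f) = (0 : M.N)

/-- `∃ i, b i`, by means of the search operator `m`. -/
def tEx (m : Term Γ Ty.two) (b : Term (Ty.nat :: Γ) Ty.nat) : Term Γ Ty.nat :=
  b.lam ⬝ (m ⬝ b.lam)

/-- `∀ i, b i`, by means of the search operator `m`. -/
def tAll (m : Term Γ Ty.two) (b : Term (Ty.nat :: Γ) Ty.nat) : Term Γ Ty.nat :=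
  tNot (tEx m (tNot b))

/-- With a search operator, arithmetical predicates acquire characteristic terms, so that induction
applies to them. -/
theorem eval_tEx (ρ : Env M.toStruc Γ) {m : Term Γ Ty.two} (hm : IsMu (m.eval ρ))
    (b : Term (Ty.nat :: Γ) Ty.nat) :
    (tEx m b).eval ρ = (0 : M.N) ↔ ∃ i : M.N, b.eval (ρ.cons i) = (0 : M.N) := by
  rw [tEx, Term.eval, Term.eval]
  refine ⟨fun h => ⟨_, by rwa [Term.eval_lam] at h⟩, fun ⟨i, h⟩ => hm _ ⟨i, ?_⟩⟩
  rwa [Term.eval_lam]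

theorem eval_tAll (ρ : Env M.toStruc Γ) {m : Term Γ Ty.two} (hm : IsMu (m.eval ρ))
    (b : Term (Ty.nat :: Γ) Ty.nat) :
    (tAll m b).eval ρ = (0 : M.N) ↔ ∀ i : M.N, b.eval (ρ.cons i) = (0 : M.N) := by
  simp [tAll, eval_tEx ρ hm]

/-- Unboundedly many numbers satisfy `P`. -/
def Unbounded (P : M.N → Prop) : Prop := ∀ b, ∃ z, b ≤ z ∧ P z

/-! ### A thin set for a function on pairs -/

/-- One step of the greedy choice of a set `D` whose pairs avoid the value `0`: the number `x` is
added if the set of the possible further elements remains infinite. -/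
def avoidStepT : Term [] (Ty.two ⇢ Ty.one ⇢ Ty.one ⇢ Ty.one) :=
  .lam (.lam (.lam (.lam (tIte (tAnd
    (tBall v0 (tImp (tLt v0 v1) (tImp (tEq (v2 ⬝ v0) numOne) (tNot (v3 ⬝ pairCode v0 v1)))))
    (tAll v3 (tEx v4 (tAnd (tSub v1 v0) (tAnd (tNot (v4 ⬝ pairCode v2 v0))
      (tBall v2 (tImp (tLt v0 v3) (tImp (tEq (v4 ⬝ v0) numOne)
        (tNot (v5 ⬝ pairCode v0 v1))))))))))
    numOne .zero))))

/-- The greedy set `D`. -/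
def avoidT : Term [] (Ty.two ⇢ Ty.one ⇢ Ty.one) :=
  .lam (.lam (covT.ofClosed ⬝ (avoidStepT.ofClosed ⬝ v1 ⬝ v0)))

def avoid (μ : M.C Ty.two) (f : M.C Ty.one) : M.C Ty.one := avoidT.eval Env.nil ◇ μ ◇ f

theorem avoid_zero_or_one (μ : M.C Ty.two) (f : M.C Ty.one) (x : M.N) :
    avoid μ f ◇ x = (0 : M.N) ∨ avoid μ f ◇ x = (1 : M.N) := by
  have h : avoid μ f = cov (avoidStepT.eval Env.nil ◇ μ ◇ f) := by simp [avoid, avoidT, cov]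
  obtain ⟨g, -, -, h3⟩ := cov_spec (avoidStepT.eval Env.nil ◇ μ ◇ f) x
  rw [h, h3]
  simp only [avoidStepT, Term.eval_lam, eval_tIte, eval_numOne]
  split_ifs
  · exact .inr rfl
  · exact .inl rfl

theorem avoid_eq_one_iff {μ : M.C Ty.two} (hμ : IsMu μ) (f : M.C Ty.one) (x : M.N) :
    avoid μ f ◇ x = (1 : M.N) ↔
      (∀ y < x, avoid μ f ◇ y = (1 : M.N) → f ◇ pc y x ≠ (0 : M.N)) ∧
      Unbounded fun z => f ◇ pc x z ≠ (0 : M.N) ∧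
        ∀ y < x, avoid μ f ◇ y = (1 : M.N) → f ◇ pc y z ≠ (0 : M.N) := by
  have h : avoid μ f = cov (avoidStepT.eval Env.nil ◇ μ ◇ f) := by simp [avoid, avoidT, cov]
  obtain ⟨g, h1, -, h3⟩ := cov_spec (avoidStepT.eval Env.nil ◇ μ ◇ f) x
  rw [← h] at h1 h3
  -- Below `x` the history `g` coincides with the set under construction; the redundant bound `y ≤
  -- x` comes from `tBall`.
  have h4 (P : M.N → Prop) : (∀ y ≤ x, y < x → g ◇ y = (1 : M.N) → P y) ↔
      ∀ y < x, avoid μ f ◇ y = (1 : M.N) → P y := by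
    constructor
    · intro h y hy
      rw [← h1 y hy]
      exact h y hy.le hy
    · intro h y _ hy
      rw [h1 y hy]
      exact h y hy
  rw [h3]
  simp only [avoidStepT, Term.eval_lam, eval_tIte, eval_numOne]
  simp [eval_tAll, eval_tEx, hμ, h4, Unbounded]

/-- The numbers above all elements of the greedy set `D`, and whose pairs with them avoid the
value `0`. -/
def Reservoir (μ : M.C Ty.two) (f : M.C Ty.one) (x : M.N) : Prop :=
  ∀ y : M.N, avoid μ f ◇ y = (1 : M.N) → y < x ∧ f ◇ pc y x ≠ (0 : M.N)

/-- One step of the greedy choice, within the reservoir of `D`, of a set whose pairs have the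
value `0`. -/
def zeroStepT : Term [] (Ty.two ⇢ Ty.one ⇢ Ty.one ⇢ Ty.one) :=
  .lam (.lam (.lam (.lam (tIte (tAnd
    (tAll v3 (tImp (tEq (avoidT.ofClosed ⬝ v4 ⬝ v3 ⬝ v0) numOne)
      (tAnd (tLt v0 v1) (tNot (v3 ⬝ pairCode v0 v1)))))
    (tBall v0 (tImp (tLt v0 v1) (tImp (tEq (v2 ⬝ v0) numOne) (v3 ⬝ pairCode v0 v1)))))
    numOne .zero))))

/-- The greedy subset of the reservoir of `D`. -/
def zeroSetT : Term [] (Ty.two ⇢ Ty.one ⇢ Ty.one) :=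
  .lam (.lam (covT.ofClosed ⬝ (zeroStepT.ofClosed ⬝ v1 ⬝ v0)))

def zeroSet (μ : M.C Ty.two) (f : M.C Ty.one) : M.C Ty.one := zeroSetT.eval Env.nil ◇ μ ◇ f

theorem zeroSet_zero_or_one (μ : M.C Ty.two) (f : M.C Ty.one) (x : M.N) :
    zeroSet μ f ◇ x = (0 : M.N) ∨ zeroSet μ f ◇ x = (1 : M.N) := by
  have h : zeroSet μ f = cov (zeroStepT.eval Env.nil ◇ μ ◇ f) := by
    simp [zeroSet, zeroSetT, cov]
  obtain ⟨g, -, -, h3⟩ := cov_spec (zeroStepT.eval Env.nil ◇ μ ◇ f) x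
  rw [h, h3]
  simp only [zeroStepT, Term.eval_lam, eval_tIte, eval_numOne]
  split_ifs
  · exact .inr rfl
  · exact .inl rfl

theorem eval_avoidT (μ : M.C Ty.two) (f : M.C Ty.one) :
    avoidT.eval Env.nil ◇ μ ◇ f = avoid μ f := rfl

theorem eval_zeroSetT (μ : M.C Ty.two) (f : M.C Ty.one) :
    zeroSetT.eval Env.nil ◇ μ ◇ f = zeroSet μ f := rfl

theorem zeroSet_eq_one_iff {μ : M.C Ty.two} (hμ : IsMu μ) (f : M.C Ty.one) (x : M.N) :
    zeroSet μ f ◇ x = (1 : M.N) ↔ Reservoir μ f x ∧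
      ∀ y < x, zeroSet μ f ◇ y = (1 : M.N) → f ◇ pc y x = (0 : M.N) := by
  have h : zeroSet μ f = cov (zeroStepT.eval Env.nil ◇ μ ◇ f) := by
    simp [zeroSet, zeroSetT, cov]
  obtain ⟨g, h1, -, h3⟩ := cov_spec (zeroStepT.eval Env.nil ◇ μ ◇ f) x
  rw [← h] at h1 h3
  have h4 (P : M.N → Prop) : (∀ y ≤ x, y < x → g ◇ y = (1 : M.N) → P y) ↔
      ∀ y < x, zeroSet μ f ◇ y = (1 : M.N) → P y := by
    constructor
    · intro h y hy
      rw [← h1 y hy]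
      exact h y hy.le hy
    · intro h y _ hy
      rw [h1 y hy]
      exact h y hy
  rw [h3]
  simp only [zeroStepT, Term.eval_lam, eval_tIte, eval_numOne]
  simp [eval_tAll, hμ, h4, Reservoir, eval_avoidT]

/-- The invariant of the greedy choice: a rejected `x` changes nothing, and an admitted `x`
satisfies the condition for admission, which is the next instance. The search operator makes this
induction on an arithmetical statement legitimate. -/
theorem unbounded_avoid {μ : M.C Ty.two} (hμ : IsMu μ) (f : M.C Ty.one) (x : M.N) :
    Unbounded fun z => ∀ y < x, avoid μ f ◇ y = (1 : M.N) → f ◇ pc y z ≠ (0 : M.N) := by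
  refine Dec.induction (P := fun x => Unbounded fun z =>
      ∀ y < x, avoid μ f ◇ y = (1 : M.N) → f ◇ pc y z ≠ (0 : M.N))
    (.of ((Env.nil.cons μ).cons f) (tAll v2 (tEx v3 (tAnd (tSub v1 v0) (tAll v4
      (tImp (tLt v0 v3) (tImp (tEq (avoidT.ofClosed ⬝ v5 ⬝ v4 ⬝ v0) numOne)
        (tNot (v4 ⬝ pairCode v0 v1)))))))) ?_) ?_ ?_ x
  · simp [eval_tAll, eval_tEx, hμ, Unbounded, eval_avoidT]
  · exact fun b => ⟨b, le_rfl, fun y hy => absurd hy (not_lt.2 zero_le)⟩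
  · intro x ih b
    rcases avoid_zero_or_one μ f x with h | h
    · obtain ⟨z, hz, h'⟩ := ih b
      refine ⟨z, hz, fun y hy hy' => ?_⟩
      rcases (Model.lt_add_one_iff.1 hy).lt_or_eq with h1 | rfl
      · exact h' y h1 hy'
      · rw [h] at hy'
        exact absurd hy' zero_ne_one
    · obtain ⟨z, hz, h1, h2⟩ := ((avoid_eq_one_iff hμ f x).1 h).2 b
      refine ⟨z, hz, fun y hy hy' => ?_⟩
      rcases (Model.lt_add_one_iff.1 hy).lt_or_eq with h3 | rfl
      · exact h2 y h3 hy'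
      · exact h1

/-- If `D` lies below `b`, then the invariant `unbounded_avoid` at `b` already concerns all of `D`.
-/
theorem unbounded_reservoir {μ : M.C Ty.two} (hμ : IsMu μ) {f : M.C Ty.one}
    (hD : ¬ Unbounded fun z => avoid μ f ◇ z = (1 : M.N)) : Unbounded (Reservoir μ f) := by
  simp only [Unbounded, not_forall, not_exists, not_and] at hD
  obtain ⟨b, hb⟩ := hD
  intro c
  obtain ⟨z, hz, h⟩ := unbounded_avoid hμ f b (max b c)
  refine ⟨z, (le_max_right _ _).trans hz, fun y hy => ?_⟩
  have hyb : y < b := not_le.1 fun h' => hb y h' hy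
  exact ⟨hyb.trans_le ((le_max_left _ _).trans hz), h y hyb hy⟩

/-- Being above `D`, the number `x` was rejected although its pairs with `D` avoid 0. So its
admission would have left only boundedly many candidates, and reservoir elements beyond that bound
must have the value 0 with `x`. -/
theorem Reservoir.eventually {μ : M.C Ty.two} (hμ : IsMu μ) {f : M.C Ty.one} {x : M.N}
    (hx : Reservoir μ f x) : ∃ c, ∀ z, c ≤ z → Reservoir μ f z → f ◇ pc x z = (0 : M.N) := by
  have h1 : avoid μ f ◇ x ≠ (1 : M.N) := fun h => lt_irrefl _ (hx x h).1
  rw [Ne, avoid_eq_one_iff hμ, not_and] at h1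
  have h2 := h1 fun y _ hy => (hx y hy).2
  simp only [Unbounded, not_forall, not_exists, not_and] at h2
  obtain ⟨c, hc⟩ := h2
  refine ⟨c, fun z hz hz' => by_contra fun h => ?_⟩
  obtain ⟨y, _, hy, h'⟩ := hc z hz h
  exact h' (hz' y hy).2

/-- A uniform bound for all `x < m`. Such bounding is not automatic in a nonstandard model; it is
proved by induction on `m` for a predicate made decidable by `μ`. -/
theorem reservoir_eventually {μ : M.C Ty.two} (hμ : IsMu μ) (f : M.C Ty.one) (m : M.N) :
    ∃ c, ∀ z, c ≤ z → Reservoir μ f z → ∀ x < m, Reservoir μ f x → f ◇ pc x z = (0 : M.N) := by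
  refine Dec.induction (P := fun m => ∃ c, ∀ z, c ≤ z → Reservoir μ f z → ∀ x < m,
      Reservoir μ f x → f ◇ pc x z = (0 : M.N))
    (.of ((Env.nil.cons μ).cons f) (tEx v2 (tAll v3 (tImp (tSub v1 v0) (tImp
      (tAll v4 (tImp (tEq (avoidT.ofClosed ⬝ v5 ⬝ v4 ⬝ v0) numOne)
        (tAnd (tLt v0 v1) (tNot (v4 ⬝ pairCode v0 v1)))))
      (tAll v4 (tImp (tLt v0 v3) (tImp
        (tAll v5 (tImp (tEq (avoidT.ofClosed ⬝ .var (.s (.s (.s (.s (.s (.s .z)))))) ⬝ v5 ⬝ v0)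
          numOne) (tAnd (tLt v0 v1) (tNot (v5 ⬝ pairCode v0 v1)))))
        (v4 ⬝ pairCode v0 v1)))))))) ?_) ?_ ?_ m
  · simp [eval_tAll, eval_tEx, hμ, Reservoir, eval_avoidT]
  · exact ⟨0, fun z _ _ x hx => absurd hx (not_lt.2 zero_le)⟩
  · rintro m ⟨c, hc⟩
    by_cases hm : Reservoir μ f m
    · obtain ⟨d, hd⟩ := hm.eventually hμ
      refine ⟨max c d, fun z hz hz' x hx hx' => ?_⟩
      rcases (Model.lt_add_one_iff.1 hx).lt_or_eq with h1 | rfl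
      · exact hc z ((le_max_left _ _).trans hz) hz' x h1 hx'
      · exact hd z ((le_max_right _ _).trans hz) hz'
    · refine ⟨c, fun z hz hz' x hx hx' => ?_⟩
      rcases (Model.lt_add_one_iff.1 hx).lt_or_eq with h1 | rfl
      · exact hc z hz hz' x h1 hx'
      · exact absurd hx' hm

/-- If the second greedy set were bounded by `m`, then a reservoir element beyond the uniform bound
for `m` would have been admitted. -/
theorem unbounded_zeroSet {μ : M.C Ty.two} (hμ : IsMu μ) {f : M.C Ty.one}
    (hD : ¬ Unbounded fun z => avoid μ f ◇ z = (1 : M.N)) :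
    Unbounded fun z => zeroSet μ f ◇ z = (1 : M.N) := by
  by_contra hE
  simp only [Unbounded, not_forall, not_exists, not_and] at hE
  obtain ⟨m, hm⟩ := hE
  obtain ⟨c, hc⟩ := reservoir_eventually hμ f m
  obtain ⟨z, hz, hz'⟩ := unbounded_reservoir hμ hD (max m c)
  refine hm z ((le_max_left _ _).trans hz) ((zeroSet_eq_one_iff hμ f z).2 ⟨hz', fun y _ hy => ?_⟩)
  exact hc z ((le_max_right _ _).trans hz) hz' y (not_le.1 fun h => hm y h hy)
    ((zeroSet_eq_one_iff hμ f y).1 hy).1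

/-- The truth value of `D` being infinite. -/
def avoidInfT : Term [] (Ty.two ⇢ Ty.two) :=
  .lam (.lam (tAll v1 (tEx v2 (tAnd (tSub v1 v0)
    (tEq (avoidT.ofClosed ⬝ v3 ⬝ v2 ⬝ v0) numOne)))))

theorem eval_avoidInfT {μ : M.C Ty.two} (hμ : IsMu μ) (f : M.C Ty.one) :
    avoidInfT.eval Env.nil ◇ μ ◇ f = (0 : M.N) ↔
      Unbounded fun z => avoid μ f ◇ z = (1 : M.N) := by
  simp [avoidInfT, eval_tAll, eval_tEx, hμ, Unbounded, eval_avoidT]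

/-- The thin set computed from the search operator. -/
def thinT : Term [] (Ty.two ⇢ Ty.one ⇢ Ty.one) :=
  .lam (.lam (.lam (tIte (avoidInfT.ofClosed ⬝ v2 ⬝ v1) (avoidT.ofClosed ⬝ v2 ⬝ v1 ⬝ v0)
    (zeroSetT.ofClosed ⬝ v2 ⬝ v1 ⬝ v0))))

/-- The omitted value computed from the search operator. -/
def omittedT : Term [] (Ty.two ⇢ Ty.two) :=
  .lam (.lam (tIte (avoidInfT.ofClosed ⬝ v1 ⬝ v0) .zero numOne))

/-- `A` is the characteristic function of a set. -/
def IsSet (A : M.C Ty.one) : Prop := ∀ x : M.N, A ◇ x = (0 : M.N) ∨ A ◇ x = (1 : M.N)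

/-- The set `A` is infinite. -/
def IsInf (A : M.C Ty.one) : Prop := Unbounded fun z : M.N => A ◇ z = (1 : M.N)

/-- The value `n` is not attained by `f` on the pairs from `A`. -/
def Omits (f A : M.C Ty.one) (n : M.N) : Prop :=
  ∀ k l : M.N, k < l → A ◇ k = (1 : M.N) → A ◇ l = (1 : M.N) → f ◇ pc k l ≠ n

theorem thin_spec {μ : M.C Ty.two} (hμ : IsMu μ) (f : M.C Ty.one) :
    IsSet (thinT.eval Env.nil ◇ μ ◇ f) ∧ IsInf (thinT.eval Env.nil ◇ μ ◇ f) ∧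
      Omits f (thinT.eval Env.nil ◇ μ ◇ f) (omittedT.eval Env.nil ◇ μ ◇ f) := by
  by_cases hD : Unbounded fun z => avoid μ f ◇ z = (1 : M.N)
  · have h1 : thinT.eval Env.nil ◇ μ ◇ f = avoid μ f := M.ext _ _ fun x => by
      simp [thinT, (eval_avoidInfT hμ f).2 hD, eval_avoidT]
    have h2 : omittedT.eval Env.nil ◇ μ ◇ f = (0 : M.N) := by
      simp [omittedT, (eval_avoidInfT hμ f).2 hD]
    rw [h1, h2]
    exact ⟨avoid_zero_or_one μ f, hD, fun k l hkl hk hl =>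
      ((avoid_eq_one_iff hμ f l).1 hl).1 k hkl hk⟩
  · have h0 := mt (eval_avoidInfT hμ f).1 hD
    have h1 : thinT.eval Env.nil ◇ μ ◇ f = zeroSet μ f := M.ext _ _ fun x => by
      simp [thinT, h0, eval_zeroSetT]
    have h2 : omittedT.eval Env.nil ◇ μ ◇ f = (1 : M.N) := by
      simp [omittedT, h0]
    rw [h1, h2]
    refine ⟨zeroSet_zero_or_one μ f, unbounded_zeroSet hμ hD, fun k l hkl hk hl => ?_⟩
    rw [((zeroSet_eq_one_iff hμ f l).1 hl).2 k hkl hk]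
    exact zero_ne_one

end

section

variable {M : Model} {Γ : Ctx}

/-! ### The search operator from a witnessed thin set functional -/

/-- `n, h ↦` the function that is `0` below the least zero of `h`, and `n` from there on. -/
def perturbT : Term [] (Ty.nat ⇢ Ty.one ⇢ Ty.one) :=
  .lam (.lam (.lam (tIte (tBex v0 (v2 ⬝ v0)) v2 .zero)))

/-- The constant function `0`. -/
def zeroFn : Term Γ Ty.one := .K _ _ ⬝ .zero

/-- The search operator computed from a thin set functional, its omitted value, and an
extensionality functional. -/
def searchT : Term [] ((Ty.one ⇢ Ty.one) ⇢ Ty.two ⇢ (Ty.one ⇢ Ty.one ⇢ Ty.nat ⇢ Ty.nat) ⇢ Ty.two) :=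
  .lam (.lam (.lam (.lam (tLz v0
    (v1 ⬝ (perturbT.ofClosed ⬝ (v2 ⬝ zeroFn) ⬝ v0) ⬝ zeroFn ⬝ .zero)))))

theorem IsInf.exists_pair {A : M.C Ty.one} (hA : IsInf A) (m : M.N) :
    ∃ k l : M.N, k < l ∧ A ◇ k = (1 : M.N) ∧ A ◇ l = (1 : M.N) ∧ m ≤ pc k l := by
  obtain ⟨k, -, hk⟩ := hA 0
  obtain ⟨l, hl, hl'⟩ := hA (max (k + 1) (m + 1))
  exact ⟨k, l, Model.add_one_le_iff.1 ((le_max_left _ _).trans hl), hk, hl',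
    le_pc (Model.add_one_le_iff.1 ((le_max_right _ _).trans hl))⟩

theorem searchT_spec {Ψ : M.C (Ty.one ⇢ Ty.one)} {N : M.C Ty.two}
    {Ξ : M.C (Ty.one ⇢ Ty.one ⇢ Ty.nat ⇢ Ty.nat)}
    (hΨ : ∀ f, IsInf (Ψ ◇ f) ∧ Omits f (Ψ ◇ f) (N ◇ f))
    (hΞ : ∀ (f g : M.C Ty.one) (k : M.N),
      (∀ i : M.N, i < (Ξ ◇ f ◇ g ◇ k : M.N) → f ◇ i = g ◇ i) → N ◇ f = N ◇ g) :
    IsMu (searchT.eval Env.nil ◇ Ψ ◇ N ◇ Ξ) := by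
  rintro h ⟨n, hn⟩
  let o : M.C Ty.one := zeroFn.eval (Env.nil (M := M.toStruc))
  let g : M.C Ty.one := perturbT.eval Env.nil ◇ (N ◇ o) ◇ h
  have ho (i : M.N) : o ◇ i = (0 : M.N) := by simp [o, zeroFn]
  have hs : searchT.eval Env.nil ◇ Ψ ◇ N ◇ Ξ ◇ h = lz h (Ξ ◇ g ◇ o ◇ 0) := by
    simp [searchT, g, o, zeroFn]
  -- From a zero `n` of `h` on, `g` has the value `N ◇ o`. The infinite set `Ψ ◇ g` has a pair with
  -- code at least `n`, so this value is attained there, whereas `N ◇ g` is omitted.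
  have h1 : N ◇ g ≠ N ◇ o := by
    intro h1
    obtain ⟨k, l, hkl, hk, hl, hm⟩ := (hΨ g).1.exists_pair n
    refine (hΨ g).2 k l hkl hk hl ?_
    rw [h1]
    have : ∃ i ≤ pc k l, h ◇ i = (0 : M.N) := ⟨n, hm, hn⟩
    simp [g, perturbT, this]
  have h2 := mt (hΞ g o 0) h1
  push Not at h2
  obtain ⟨i, hi, hgi⟩ := h2
  rw [hs]
  have h3 : ∃ j ≤ i, h ◇ j = (0 : M.N) := by
    by_contra h3
    refine hgi ?_
    rw [ho]
    simp [g, perturbT, h3]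
  obtain ⟨j, hj, hj'⟩ := h3
  exact (lz_spec (hj.trans hi.le) hj').1

/-! ### Discontinuous functionals yield the search operator -/

/-- Grilliot's trick: a term-definable `H` sends `h` to the limit `f` if `h` has no zero, and
otherwise to some `F ◇ j` at which `G` is nonzero. Then `G` after `H` decides whether `h` has a
zero. -/
theorem exists_isMu_of_discontinuous {G : M.C Ty.two} {F : M.C (Ty.nat ⇢ Ty.one)} {f : M.C Ty.one}
    (hf : G ◇ f = (0 : M.N)) (hF : ∀ j i : M.N, i < j → F ◇ j ◇ i = f ◇ i)
    (hG : ∀ J : M.N, ∃ j : M.N, J ≤ j ∧ G ◇ (F ◇ j) ≠ (0 : M.N)) :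
    ∃ μ : M.C Ty.two, IsMu μ := by
  -- Choice is available for arguments of type 1, so the number `J` is passed as the value `q ◇ 0`
  -- of a function.
  obtain ⟨j, hj⟩ := M.qfac ((Term.lam (.lam (tAnd (tSub (v1 ⬝ .zero) v0)
    (tNot (v3 ⬝ (v2 ⬝ v0)))))).eval ((Env.nil.cons G).cons F)) (fun q => by
      simpa using hG (q ◇ (0 : M.N)))
  have hj1 (q : M.C Ty.one) : (q ◇ (0 : M.N) : M.N) ≤ j ◇ q ∧ G ◇ (F ◇ (j ◇ q)) ≠ (0 : M.N) := by
    simpa using hj q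
  -- The value at `i` needs only a search up to `i`. If the least zero `t` of `h` is beyond `i`,
  -- then `f` gives the right value, since the chosen index is at least `t` and `F` agrees with `f`
  -- below its index.
  let H : M.C (Ty.one ⇢ Ty.one) := (Term.lam (.lam (tIte (tBex v0 (v2 ⬝ v0))
    (v4 ⬝ (v2 ⬝ (.K _ _ ⬝ tLz v1 v0)) ⬝ v0) (v3 ⬝ v0)))).eval
      (((Env.nil.cons F).cons f).cons j)
  have hH (h : M.C Ty.one) : G ◇ (H ◇ h) ≠ (0 : M.N) ↔ ∃ n : M.N, h ◇ n = (0 : M.N) := by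
    constructor
    · intro h1
      by_contra h2
      push Not at h2
      have : H ◇ h = f := M.ext _ _ fun i => by simp [H, h2]
      exact h1 (this ▸ hf)
    · intro h1
      have hd : Dec fun n : M.N => h ◇ n = (0 : M.N) := ⟨h, fun _ => Iff.rfl⟩
      obtain ⟨t, ht, ht'⟩ := hd.exists_least h1
      have h2 := hj1 (M.K _ _ ◇ t)
      rw [M.K_ap] at h2
      have : H ◇ h = F ◇ (j ◇ (M.K _ _ ◇ t)) := M.ext _ _ fun i => by
        by_cases hi : t ≤ i
        · have h3 : ∃ n ≤ i, h ◇ n = (0 : M.N) := ⟨t, hi, ht⟩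
          simp [H, h3, lz_eq hi ht ht']
        · have h3 : ¬ ∃ n ≤ i, h ◇ n = (0 : M.N) := by
            rintro ⟨n, hn, hn'⟩
            exact ht' n (hn.trans_lt (not_le.1 hi)) hn'
          rw [hF _ _ ((not_le.1 hi).trans_le h2.1)]
          simp [H, h3]
      rw [this]
      exact h2.2
  -- The premise that `h` has a zero is now quantifier-free, so that choice can select one.
  obtain ⟨μ, hμ⟩ := M.qfac ((Term.lam (.lam (tImp (tNot (v3 ⬝ (v2 ⬝ v1))) (v1 ⬝ v0)))).eval
    ((Env.nil.cons G).cons H)) (fun h => by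
      by_cases h1 : G ◇ (H ◇ h) = (0 : M.N)
      · exact ⟨0, by simp [h1]⟩
      · obtain ⟨n, hn⟩ := (hH h).1 h1
        exact ⟨n, by simp [hn]⟩)
  refine ⟨μ, fun h h1 => ?_⟩
  have := hμ h
  simp only [Term.eval_lam, Model.zero_eq, eval_tImp, eval_tNot, Term.eval, Env.cons] at this
  exact this ((hH h).2 h1)

/-- Without a search operator, all functionals of type `1 → 1` are sequentially continuous. -/
theorem seq_continuous (hM : ¬ ∃ μ : M.C Ty.two, IsMu μ) (Ψ : M.C (Ty.one ⇢ Ty.one))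
    {F : M.C (Ty.nat ⇢ Ty.one)} {f : M.C Ty.one} (hF : ∀ j i : M.N, i < j → F ◇ j ◇ i = f ◇ i)
    (k : M.N) :
    ∃ J : M.N, ∀ j, J ≤ j → ∀ i < k, Ψ ◇ (F ◇ j) ◇ i = Ψ ◇ f ◇ i := by
  by_contra h
  push Not at h
  let G : M.C Ty.two := (Term.lam (tBall v1 (tImp (tLt v0 v2)
    (tEq (v4 ⬝ v1 ⬝ v0) (v4 ⬝ v3 ⬝ v0))))).eval (((Env.nil.cons Ψ).cons f).cons k)
  have hG (g : M.C Ty.one) : G ◇ g = (0 : M.N) ↔ ∀ i < k, Ψ ◇ g ◇ i = Ψ ◇ f ◇ i := by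
    simp only [G, Term.eval_lam, eval_tBall, eval_tImp, eval_tLt, eval_tEq, Term.eval, Env.cons]
    exact ⟨fun h i hi => h i hi.le hi, fun h i _ hi => h i hi⟩
  refine hM (exists_isMu_of_discontinuous ((hG f).2 fun _ _ => rfl) hF fun J => ?_)
  obtain ⟨j, hJ, i, hi, hne⟩ := h J
  exact ⟨j, hJ, fun h' => hne ((hG _).1 h' i hi)⟩

end

section

variable {M : Model} {Γ : Ctx}

/-! ### A function all of whose values occur on its own candidate for a thin set -/

/-- `g, n, p, q ↦` the function `g`, changed to `n` on the interval `[p, q)`. -/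
def patchT : Term [] (Ty.one ⇢ Ty.nat ⇢ Ty.nat ⇢ Ty.nat ⇢ Ty.one) :=
  .lam (.lam (.lam (.lam (.lam (tIte (tAnd (tSub v2 v0) (tLt v0 v1)) v3 (v4 ⬝ v0))))))

def patch (g : M.C Ty.one) (n p q : M.N) : M.C Ty.one := patchT.eval Env.nil ◇ g ◇ n ◇ p ◇ q

open Classical in
theorem patch_ap (g : M.C Ty.one) (n p q i : M.N) :
    patch g n p q ◇ i = if p ≤ i ∧ i < q then n else g ◇ i := by
  simp [patch, patchT]

/-- Sequential continuity is used twice. Setting `g` to `n` from a far `p` on does not affect `Ψ`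
below `Q`, and the resulting infinite set has a pair with code at least `p`. Ending the change at a
far `q` preserves that pair and the values below `Q`. -/
theorem exists_patch (hM : ¬ ∃ μ : M.C Ty.two, IsMu μ) {Ψ : M.C (Ty.one ⇢ Ty.one)}
    (hΨ : ∀ f, IsInf (Ψ ◇ f)) (g : M.C Ty.one) (Q n : M.N) :
    ∃ p q : M.N, Q ≤ p ∧ (∀ i < Q, Ψ ◇ patch g n p q ◇ i = Ψ ◇ g ◇ i) ∧
      ∃ x y : M.N, x < y ∧ y < q ∧ Ψ ◇ patch g n p q ◇ x = (1 : M.N) ∧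
        Ψ ◇ patch g n p q ◇ y = (1 : M.N) ∧ p ≤ pc x y ∧ pc x y < q := by
  let T : M.C (Ty.nat ⇢ Ty.one) :=
    (Term.lam (.lam (tIte (tSub v1 v0) v2 (v3 ⬝ v0)))).eval ((Env.nil.cons g).cons n)
  have hT (p i : M.N) (h : i < p) : T ◇ p ◇ i = g ◇ i := by simp [T, h]
  obtain ⟨p', hp'⟩ := seq_continuous hM Ψ hT Q
  let p := max p' Q
  let U : M.C (Ty.nat ⇢ Ty.one) :=
    (Term.lam (patchT.ofClosed ⬝ v3 ⬝ v2 ⬝ v1 ⬝ v0)).eval (((Env.nil.cons g).cons n).cons p)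
  have hU (q : M.N) : U ◇ q = patch g n p q := by simp [U, patch]
  obtain ⟨x, y, hxy, hx, hy, hpc⟩ := (hΨ (T ◇ p)).exists_pair p
  obtain ⟨q', hq'⟩ := seq_continuous hM Ψ (F := U) (f := T ◇ p) (fun q i hi => by
    rw [hU, patch_ap]
    by_cases h : p ≤ i
    · simp [T, h, hi]
    · simp [T, h]) (max Q (y + 1))
  -- The end of the interval is beyond the continuity threshold, the elements of the pair, and its
  -- code.
  have hq := hq' (max q' (max (y + 1) (pc x y + 1))) (le_max_left _ _)
  rw [hU] at hq
  have hlt := Model.lt_add_one y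
  refine ⟨p, max q' (max (y + 1) (pc x y + 1)), le_max_right _ _, fun i hi => ?_,
    x, y, hxy, ?_, ?_, ?_, hpc, ?_⟩
  · rw [hq i (hi.trans_le (le_max_left _ _)), hp' p (le_max_left _ _) i hi]
  · exact hlt.trans_le ((le_max_left _ _).trans (le_max_right _ _))
  · rw [hq x ((hxy.trans hlt).trans_le (le_max_right _ _)), hx]
  · rw [hq y (hlt.trans_le (le_max_right _ _)), hy]
  · exact (Model.lt_add_one _).trans_le ((le_max_right _ _).trans (le_max_right _ _))

/-- `i` is in the interval with the number `c` of the sequence `h` of intervals. -/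
def InBlock (h : M.C Ty.one) (i c : M.N) : Prop :=
  fst (h ◇ c : M.N) ≤ i ∧ i < snd (h ◇ c : M.N)

/-- The characteristic function of `{c | InBlock h i c}`, for given `h`, `i`. -/
def inBlockT : Term [] (Ty.one ⇢ Ty.nat ⇢ Ty.one) :=
  .lam (.lam (.lam (tAnd (tSub (tFst (v2 ⬝ v0)) v1) (tLt v1 (tSnd (v2 ⬝ v0))))))

theorem inBlockT_spec (h : M.C Ty.one) (i c : M.N) :
    inBlockT.eval Env.nil ◇ h ◇ i ◇ c = (0 : M.N) ↔ InBlock h i c := by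
  simp [inBlockT, InBlock]

/-- `h, n ↦` the function with the value `c` on the interval number `c` of `h`, for `c < n`, and
`0` elsewhere. -/
def blocksT : Term [] (Ty.one ⇢ Ty.nat ⇢ Ty.one) :=
  .lam (.lam (.lam (.app
    -- The search up to `n` returns `n` when it fails, and also when only the interval number `n`
    -- contains the argument; the strict guard rejects both cases.
    (.lam (tIte (tAnd (tLt v0 v2) (inBlockT.ofClosed ⬝ v3 ⬝ v1 ⬝ v0)) v0 .zero))
    (tLz (inBlockT.ofClosed ⬝ v2 ⬝ v0) v1))))

def blocks (h : M.C Ty.one) (n : M.N) : M.C Ty.one := blocksT.eval Env.nil ◇ h ◇ n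

theorem blocks_eq {h : M.C Ty.one} {n i c : M.N} (hc : c < n) (hi : InBlock h i c)
    (hl : ∀ d < c, ¬ InBlock h i d) : blocks h n ◇ i = c := by
  have : lz (inBlockT.eval Env.nil ◇ h ◇ i) n = c :=
    lz_eq hc.le ((inBlockT_spec h i c).2 hi) fun d hd => mt (inBlockT_spec h i d).1 (hl d hd)
  simp [blocks, blocksT, this, inBlockT_spec, hi, hc]

theorem blocks_eq_zero {h : M.C Ty.one} {n i : M.N} (hn : ∀ c < n, ¬ InBlock h i c) :
    blocks h n ◇ i = (0 : M.N) := by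
  simp only [blocks, blocksT, Term.eval_lam, Term.eval, eval_tIte, eval_tAnd, eval_tLt,
    inBlockT_spec, Term.eval_ofClosed, Env.cons, Model.zero_eq, ite_eq_right_iff]
  exact fun h' => absurd h'.2 (hn _ h'.1)

theorem exists_least_inBlock {h : M.C Ty.one} {n i : M.N} (hn : ∃ c < n, InBlock h i c) :
    ∃ c < n, InBlock h i c ∧ ∀ d < c, ¬ InBlock h i d := by
  obtain ⟨c, hc, hi⟩ := hn
  obtain ⟨d, hd, hd'⟩ := Dec.exists_least (P := InBlock h i)
    ⟨inBlockT.eval Env.nil ◇ h ◇ i, inBlockT_spec h i⟩ ⟨c, hi⟩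
  exact ⟨d, (not_lt.1 fun h' => hd' c h' hi).trans_lt hc, hd, hd'⟩

/-- Only the history below `n` matters, so in the course-of-values recursion the history may be
replaced by the final sequence. -/
theorem blocks_congr {h h' : M.C Ty.one} {n : M.N} (hh : ∀ c < n, h ◇ c = h' ◇ c) :
    blocks h n = blocks h' n := by
  refine M.ext _ _ fun i => ?_
  have key (c : M.N) (hc : c < n) : InBlock h i c ↔ InBlock h' i c := by
    rw [InBlock, InBlock, hh c hc]
  by_cases hn : ∃ c < n, InBlock h i c
  · obtain ⟨c, hc, hi, hl⟩ := exists_least_inBlock hn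
    rw [blocks_eq hc hi hl, blocks_eq hc ((key c hc).1 hi) fun d hd =>
      mt (key d (hd.trans hc)).2 (hl d hd)]
  · push Not at hn
    rw [blocks_eq_zero hn, blocks_eq_zero fun c hc => mt (key c hc).2 (hn c hc)]

/-- The right end of the interval before the interval number `n`. -/
def tEnd (h : Term Γ Ty.one) (n : Term Γ Ty.nat) : Term Γ Ty.nat :=
  tIte n .zero (tSnd (h ⬝ tSub n numOne))

def blockEnd (h : M.C Ty.one) (n : M.N) : M.N := (tEnd v1 v0).eval ((Env.nil.cons h).cons n)

theorem eval_tEnd (ρ : Env M.toStruc Γ) (h : Term Γ Ty.one) (n : Term Γ Ty.nat) :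
    (tEnd h n).eval ρ = blockEnd (h.eval ρ) (n.eval ρ : M.N) := by
  simp [tEnd, blockEnd]

theorem blockEnd_add_one (h : M.C Ty.one) (n : M.N) :
    blockEnd h (n + 1) = snd (h ◇ n : M.N) := by
  simp [blockEnd, tEnd, Model.add_sub_cancel_right']

theorem blockEnd_congr {h h' : M.C Ty.one} {n : M.N} (hh : ∀ c < n, h ◇ c = h' ◇ c) :
    blockEnd h n = blockEnd h' n := by
  rcases Model.eq_zero_or n with rfl | ⟨m, rfl⟩
  · simp [blockEnd, tEnd]
  · rw [blockEnd_add_one, blockEnd_add_one, hh m (Model.lt_add_one m)]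

/-- The function for the intervals before the number `n`, with one more interval coded by `z`. -/
def extend (h : M.C Ty.one) (n z : M.N) : M.C Ty.one := patch (blocks h n) n (fst z) (snd z)

/-- The code `z` of an interval may be used as the number `n` of a sequence of intervals: the new
function attains the value `n` on the set that `Ψ` yields, and `Ψ` has kept its values below the
previous intervals. -/
def IsStep (Ψ : M.C (Ty.one ⇢ Ty.one)) (h : M.C Ty.one) (n z : M.N) : Prop :=
  blockEnd h n ≤ fst z ∧
    (∀ i < blockEnd h n, Ψ ◇ extend h n z ◇ i = Ψ ◇ blocks h n ◇ i) ∧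
    ∃ x y : M.N, x < y ∧ y < snd z ∧ Ψ ◇ extend h n z ◇ x = (1 : M.N) ∧
      Ψ ◇ extend h n z ◇ y = (1 : M.N) ∧ fst z ≤ pc x y ∧ pc x y < snd z

def extendT : Term [] (Ty.one ⇢ Ty.nat ⇢ Ty.nat ⇢ Ty.one) :=
  .lam (.lam (.lam (patchT.ofClosed ⬝ (blocksT.ofClosed ⬝ v2 ⬝ v1) ⬝ v1 ⬝ tFst v0 ⬝ tSnd v0)))

theorem eval_extendT (h : M.C Ty.one) (n z : M.N) :
    extendT.eval Env.nil ◇ h ◇ n ◇ z = extend h n z := by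
  simp [extendT, extend, patch, blocks]

theorem eval_blocksT (h : M.C Ty.one) (n : M.N) :
    blocksT.eval Env.nil ◇ h ◇ n = blocks h n := rfl

/-- The characteristic function of `IsStep`. -/
def isStepT : Term [] ((Ty.one ⇢ Ty.one) ⇢ Ty.one ⇢ Ty.nat ⇢ Ty.one) :=
  .lam (.lam (.lam (.lam (tAnd (tSub (tEnd v2 v1) (tFst v0)) (tAnd
    (tBall (tEnd v2 v1) (tImp (tLt v0 (tEnd v3 v2))
      (tEq (v4 ⬝ (extendT.ofClosed ⬝ v3 ⬝ v2 ⬝ v1) ⬝ v0) (v4 ⬝ (blocksT.ofClosed ⬝ v3 ⬝ v2) ⬝ v0))))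
    (tBex (tSnd v0) (tBex (tSnd v1) (tAnd (tLt v1 v0) (tAnd (tLt v0 (tSnd v2))
      (tAnd (tEq (v5 ⬝ (extendT.ofClosed ⬝ v4 ⬝ v3 ⬝ v2) ⬝ v1) numOne)
      (tAnd (tEq (v5 ⬝ (extendT.ofClosed ⬝ v4 ⬝ v3 ⬝ v2) ⬝ v0) numOne)
      (tAnd (tSub (tFst v2) (pairCode v1 v0)) (tLt (pairCode v1 v0) (tSnd v2))))))))))))))

/-- The requirement `y < snd z` in `IsStep` bounds the search for the pair, which makes the
condition quantifier-free and hence accessible to choice. -/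
theorem isStepT_spec (Ψ : M.C (Ty.one ⇢ Ty.one)) (h : M.C Ty.one) (n z : M.N) :
    isStepT.eval Env.nil ◇ Ψ ◇ h ◇ n ◇ z = (0 : M.N) ↔ IsStep Ψ h n z := by
  simp only [isStepT, Term.eval_lam, Term.eval, Env.cons, eval_tAnd, eval_tSub, eval_tEnd,
    eval_tFst, eval_tSnd, eval_tBall, eval_tImp, eval_tLt, eval_tEq, eval_tBex, eval_pairCode,
    Term.eval_ofClosed, eval_extendT, eval_blocksT, eval_numOne, sub_eq_zero', IsStep]
  refine and_congr Iff.rfl (and_congr ⟨fun h i hi => h i hi.le hi, fun h i _ hi => h i hi⟩ ?_)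
  constructor
  · rintro ⟨x, -, y, -, h⟩
    exact ⟨x, y, h⟩
  · rintro ⟨x, y, h⟩
    exact ⟨x, (h.1.trans h.2.1).le, y, h.2.1.le, h⟩

/-- The function `i ↦ e (i + 1)`. -/
def shiftT : Term [] (Ty.one ⇢ Ty.one) := .lam (.lam (v1 ⬝ (.succ ⬝ v0)))

/-- The function `e` with `e 0 = n` and `e (i + 1) = h i`. -/
def consT : Term [] (Ty.one ⇢ Ty.nat ⇢ Ty.one) :=
  .lam (.lam (.lam (tIte v0 v1 (v2 ⬝ tSub v0 numOne))))

theorem consT_zero (h : M.C Ty.one) (n : M.N) :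
    consT.eval Env.nil ◇ h ◇ n ◇ (0 : M.N) = n := by
  simp [consT]

theorem shiftT_consT (h : M.C Ty.one) (n : M.N) :
    shiftT.eval Env.nil ◇ (consT.eval Env.nil ◇ h ◇ n) = h :=
  M.ext _ _ fun i => by simp [consT, shiftT, Model.add_sub_cancel_right']

/-- `exists_patch` supplies a next interval for every history. Choice with a type 1 argument selects
one uniformly, after history and stage have been packed into one function by `consT`. -/
theorem exists_step_functional (hM : ¬ ∃ μ : M.C Ty.two, IsMu μ) {Ψ : M.C (Ty.one ⇢ Ty.one)}
    (hΨ : ∀ f, IsInf (Ψ ◇ f)) :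
    ∃ F : M.C Ty.two, ∀ (h : M.C Ty.one) (n : M.N),
      IsStep Ψ h n (F ◇ (consT.eval Env.nil ◇ h ◇ n)) := by
  let G : M.C (Ty.one ⇢ Ty.nat ⇢ Ty.nat) := (Term.lam (.lam (isStepT.ofClosed ⬝ v2 ⬝
    (shiftT.ofClosed ⬝ v1) ⬝ (v1 ⬝ .zero) ⬝ v0))).eval (Env.nil.cons Ψ)
  have hG (e : M.C Ty.one) (z : M.N) :
      G ◇ e ◇ z = (0 : M.N) ↔ IsStep Ψ (shiftT.eval Env.nil ◇ e) (e ◇ (0 : M.N)) z := by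
    rw [← isStepT_spec]
    simp only [G, Term.eval_lam, Term.eval, Env.cons, Term.eval_ofClosed, Model.zero_eq]
  obtain ⟨F, hF⟩ := M.qfac G fun e => by
    obtain ⟨p, q, h1, h2, h3⟩ := exists_patch hM hΨ
      (blocks (shiftT.eval Env.nil ◇ e) (e ◇ (0 : M.N)))
      (blockEnd (shiftT.eval Env.nil ◇ e) (e ◇ (0 : M.N))) (e ◇ (0 : M.N))
    refine ⟨pair p q, (hG _ _).2 ?_⟩
    rw [IsStep, extend, fst_pair, snd_pair]
    exact ⟨h1, h2, h3⟩
  refine ⟨F, fun h n => ?_⟩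
  have := (hG _ _).1 (hF (consT.eval Env.nil ◇ h ◇ n))
  rwa [shiftT_consT, consT_zero] at this

theorem exists_steps (hM : ¬ ∃ μ : M.C Ty.two, IsMu μ) {Ψ : M.C (Ty.one ⇢ Ty.one)}
    (hΨ : ∀ f, IsInf (Ψ ◇ f)) : ∃ D : M.C Ty.one, ∀ n : M.N, IsStep Ψ D n (D ◇ n) := by
  obtain ⟨F, hF⟩ := exists_step_functional hM hΨ
  let Φ : M.C (Ty.one ⇢ Ty.one) :=
    (Term.lam (.lam (v2 ⬝ (consT.ofClosed ⬝ v1 ⬝ v0)))).eval (Env.nil.cons F)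
  have hΦ (h : M.C Ty.one) (n : M.N) : Φ ◇ h ◇ n = F ◇ (consT.eval Env.nil ◇ h ◇ n) := by
    simp [Φ]
  refine ⟨cov Φ, fun n => ?_⟩
  obtain ⟨h, h1, -, h3⟩ := cov_spec Φ n
  have h2 := hF h n
  rw [← hΦ, ← h3] at h2
  rw [IsStep, extend, blocks_congr h1, blockEnd_congr h1] at h2
  exact h2

/-- A functional that yields infinite sets, one of whose values is omitted, yields the search
operator. -/
theorem exists_isMu {Ψ : M.C (Ty.one ⇢ Ty.one)}
    (hΨ : ∀ f, IsInf (Ψ ◇ f) ∧ ∃ n, Omits f (Ψ ◇ f) n) : ∃ μ : M.C Ty.two, IsMu μ := by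
  by_contra hM
  obtain ⟨D, hD⟩ := exists_steps hM fun f => (hΨ f).1
  let p : M.N → M.N := fun n => fst (D ◇ n : M.N)
  let q : M.N → M.N := fun n => snd (D ◇ n : M.N)
  have hpq (n : M.N) : p n < q n := by
    obtain ⟨-, -, x, y, -, -, -, -, h1, h2⟩ := hD n
    exact h1.trans_lt h2
  have hqp (n : M.N) : q n ≤ p (n + 1) := by
    have := (hD (n + 1)).1
    rwa [blockEnd_add_one] at this
  have hmono (c n : M.N) : c < n → q c ≤ p n := by
    refine Dec.induction (P := fun n => c < n → q c ≤ p n)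
      (.of ((Env.nil.cons D).cons c) (tImp (tLt v1 v0)
        (tSub (tSnd (v2 ⬝ v1)) (tFst (v2 ⬝ v0)))) (by simp [p, q])) ?_ ?_ n
    · exact fun h => absurd h (not_lt.2 zero_le)
    · intro n ih h
      rcases (Model.lt_add_one_iff.1 h).lt_or_eq with h | rfl
      · exact ((ih h).trans (hpq n).le).trans (hqp n)
      · exact hqp c
  have hle (n : M.N) : n ≤ p n := by
    refine Dec.induction (P := fun n => n ≤ p n)
      (.of (Env.nil.cons D) (tSub v0 (tFst (v1 ⬝ v0))) (by simp [p])) zero_le ?_ n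
    intro n ih
    exact Model.add_one_le_iff.2 (ih.trans_lt ((hpq n).trans_le (hqp n)))
  have hlt {c n i : M.N} (hc : InBlock D i c) (hi : i < p n) : c < n := by
    by_contra h
    rcases (not_lt.1 h).lt_or_eq with h1 | rfl
    · exact absurd ((hmono n c h1).trans hc.1) (not_le.2 (hi.trans (hpq n)))
    · exact absurd hc.1 (not_le.2 hi)
  have hdisj {c n i : M.N} (hc : InBlock D i c) (hn : p n ≤ i) : ¬ c < n := fun h =>
    absurd ((hmono c n h).trans hn) (not_le.2 hc.2)
  have hval {c n i : M.N} (hcn : c < n) (hc : InBlock D i c) : blocks D n ◇ i = c :=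
    blocks_eq hcn hc fun d hd hd' => hdisj hd' hc.1 hd
  -- The intervals are disjoint, so patching in interval `n` overwrites no earlier one and yields
  -- the next approximation.
  have hnext (n : M.N) : extend D n (D ◇ n) = blocks D (n + 1) := M.ext _ _ fun i => by
    rw [extend, patch_ap]
    split_ifs with h
    · exact (hval (Model.lt_add_one n) h).symm
    · by_cases h' : ∃ c < n, InBlock D i c
      · obtain ⟨c, hc, hi⟩ := h'
        rw [hval hc hi, hval (hc.trans (Model.lt_add_one n)) hi]
      · push Not at h'
        rw [blocks_eq_zero h', blocks_eq_zero]
        intro c hc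
        rcases (Model.lt_add_one_iff.1 hc).lt_or_eq with h1 | rfl
        · exact h' c h1
        · exact h
  let B : M.C (Ty.nat ⇢ Ty.one) := (Term.lam (blocksT.ofClosed ⬝ v1 ⬝ v0)).eval (Env.nil.cons D)
  have hB (n : M.N) : B ◇ n = blocks D n := by simp [B, blocks]
  -- The limit is read off diagonally: as `n ≤ p n`, only intervals with number at most `i` can
  -- contain `i`, and all of these are present at stage `i + 1`.
  let f : M.C Ty.one := (Term.lam (v1 ⬝ (.succ ⬝ v0) ⬝ v0)).eval (Env.nil.cons B)
  have hf (i : M.N) : f ◇ i = blocks D (i + 1) ◇ i := by simp [f, hB]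
  have hfval {c i : M.N} (hc : InBlock D i c) : f ◇ i = c := by
    rw [hf]
    exact hval (Model.lt_add_one_iff.2 ((hle c).trans hc.1)) hc
  have hBf (n i : M.N) (hi : i < n) : B ◇ n ◇ i = f ◇ i := by
    rw [hB]
    by_cases h : ∃ c, InBlock D i c
    · obtain ⟨c, hc⟩ := h
      rw [hfval hc, hval (hlt hc (hi.trans_le (hle n))) hc]
    · push Not at h
      rw [hf, blocks_eq_zero fun c _ => h c, blocks_eq_zero fun c _ => h c]
  -- Each later step preserves `Ψ` below the previous right end, which is at least `q n`. The claim
  -- is an equation, so induction applies.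
  have hkeep (n i : M.N) (hi : i < q n) (m : M.N) :
      Ψ ◇ blocks D (n + 1 + m) ◇ i = Ψ ◇ blocks D (n + 1) ◇ i := by
    refine Dec.induction
      (P := fun m => Ψ ◇ blocks D (n + 1 + m) ◇ i = Ψ ◇ blocks D (n + 1) ◇ i)
      (.of ((((Env.nil.cons Ψ).cons B).cons (n + 1)).cons i)
        (tEq (v4 ⬝ (v3 ⬝ (add ⬝ v2 ⬝ v0)) ⬝ v1) (v4 ⬝ (v3 ⬝ v2) ⬝ v1)) (by simp [hB])) ?_ ?_ m
    · rw [add_zero]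
    · intro m ih
      have h1 := (hD (n + 1 + m)).2.1 i
      rw [hnext, ih] at h1
      rw [← add_assoc]
      refine h1 ?_
      rw [add_right_comm, blockEnd_add_one]
      rcases (le_self_add : n ≤ n + m).lt_or_eq with h2 | h2
      · exact hi.trans_le ((hmono _ _ h2).trans (hpq _).le)
      · rwa [← h2]
  -- Stage `n` attained precisely the supposedly omitted value `n`; its pair persists to `Ψ ◇ f` by
  -- `hkeep` and sequential continuity.
  obtain ⟨-, n, hn⟩ := hΨ f
  obtain ⟨-, -, x, y, hxy, hy, hx1, hy1, h1, h2⟩ := hD n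
  rw [hnext] at hx1 hy1
  obtain ⟨J, hJ⟩ := seq_continuous hM Ψ hBf (q n)
  have hlim (i : M.N) (hi : i < q n) : Ψ ◇ f ◇ i = Ψ ◇ blocks D (n + 1) ◇ i := by
    rw [← hJ (n + 1 + J) le_add_self i hi, hB, hkeep n i hi]
  refine hn x y hxy ?_ ?_ (hfval ⟨h1, h2⟩)
  · rw [hlim x (hxy.trans hy), hx1]
  · rw [hlim y hy, hy1]

end

section

/-! ### The formulas of the theorem in a model -/

variable {M : Model} {Γ : Ctx} (ρ : Env M.toStruc Γ)

theorem sat_neg (φ : Formula Γ) : (neg φ).Sat ρ ↔ ¬ φ.Sat ρ := Iff.rfl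

theorem sat_imp (φ ψ : Formula Γ) : (φ ⇾ ψ).Sat ρ ↔ (φ.Sat ρ → ψ.Sat ρ) := Iff.rfl

theorem sat_eq (a b : Term Γ Ty.nat) : (a ≐ b).Sat ρ ↔ (a.eval ρ : M.N) = b.eval ρ := Iff.rfl

theorem sat_all {σ : Ty} (φ : Formula (σ :: Γ)) : (all σ φ).Sat ρ ↔ ∀ c, φ.Sat (ρ.cons c) :=
  Iff.rfl

theorem sat_and (φ ψ : Formula Γ) : (φ ⋀ ψ).Sat ρ ↔ φ.Sat ρ ∧ ψ.Sat ρ := by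
  simp only [Formula.and, sat_neg, sat_imp]
  tauto

theorem sat_or (φ ψ : Formula Γ) : (φ ⋁ ψ).Sat ρ ↔ φ.Sat ρ ∨ ψ.Sat ρ := by
  simp only [Formula.or, sat_neg, sat_imp]
  tauto

theorem sat_iff (φ ψ : Formula Γ) : (Formula.iff φ ψ).Sat ρ ↔ (φ.Sat ρ ↔ ψ.Sat ρ) := by
  simp only [Formula.iff, sat_and, sat_imp]
  tauto

theorem sat_ex {σ : Ty} (φ : Formula (σ :: Γ)) :
    (ex σ φ).Sat ρ ↔ ∃ c, φ.Sat (ρ.cons c) := by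
  simp only [Formula.ex, sat_neg, sat_all, not_forall, not_not]

theorem sat_le (a b : Term Γ Ty.nat) : (le a b).Sat ρ ↔ (a.eval ρ : M.N) ≤ b.eval ρ := by
  simp only [le, sat_ex, sat_eq, Term.eval, Term.eval_wk, eval_add, Env.cons]
  exact Iff.rfl

theorem sat_lt (a b : Term Γ Ty.nat) : (lt a b).Sat ρ ↔ (a.eval ρ : M.N) < b.eval ρ := by
  rw [lt, sat_le, Term.eval, Term.eval, Model.succ_eq, Model.add_one_le_iff]

theorem sat_agree (f g : Term Γ Ty.one) (n : Term Γ Ty.nat) : (agree f g n).Sat ρ ↔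
    ∀ i : M.N, i < (n.eval ρ : M.N) → f.eval ρ ◇ i = g.eval ρ ◇ i := by
  simp only [agree, sat_all, sat_imp, sat_lt, sat_eq, Term.eval, Term.eval_wk, Env.cons]

theorem sat_isSet (A : Term Γ Ty.one) : (isSet A).Sat ρ ↔ IsSet (A.eval ρ) := by
  simp only [isSet, sat_all, sat_or, sat_eq, Term.eval, Term.eval_wk, Env.cons, eval_numOne,
    Model.zero_eq, IsSet]

theorem sat_infinite (A : Term Γ Ty.one) : (infinite A).Sat ρ ↔ IsInf (A.eval ρ) := by
  simp only [infinite, mem, sat_all, sat_ex, sat_and, sat_le, sat_eq, Term.eval, Term.eval_wk,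
    Env.cons, eval_numOne, IsInf, Unbounded]

theorem sat_omits (f A : Term Γ Ty.one) (n : Term Γ Ty.nat) :
    (omits f A n).Sat ρ ↔ Omits (f.eval ρ) (A.eval ρ) (n.eval ρ) := by
  simp only [omits, mem, sat_all, sat_imp, sat_and, sat_neg, sat_lt, sat_eq, Term.eval,
    Term.eval_wk, Env.cons, eval_numOne, eval_pairCode, Omits, and_imp, ne_eq]

theorem sat_MU (μ : Term Γ Ty.two) : (MU μ).Sat ρ ↔ IsMu (μ.eval ρ) := by
  simp only [MU, sat_all, sat_imp, sat_ex, sat_eq, Term.eval, Term.eval_wk, Env.cons,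
    Model.zero_eq, IsMu]

/-- `Ψ` is a thin set functional. -/
def IsUTS (Ψ : M.C (Ty.one ⇢ Ty.one)) : Prop :=
  ∀ f, IsSet (Ψ ◇ f) ∧ IsInf (Ψ ◇ f) ∧ ∃ n, Omits f (Ψ ◇ f) n

/-- `Ψ` is a thin set functional with the omitted values given by `N`. -/
def IsUTSWit (Ψ : M.C (Ty.one ⇢ Ty.one)) (N : M.C Ty.two) : Prop :=
  ∀ f, IsSet (Ψ ◇ f) ∧ IsInf (Ψ ◇ f) ∧ Omits f (Ψ ◇ f) (N ◇ f)

/-- `Ξ` is an extensionality functional for `Ψ` and `N`. -/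
def IsExtFun (Ξ : M.C (Ty.one ⇢ Ty.one ⇢ Ty.nat ⇢ Ty.nat)) (Ψ : M.C (Ty.one ⇢ Ty.one))
    (N : M.C Ty.two) : Prop :=
  ∀ (f g : M.C Ty.one) (k : M.N), (∀ i : M.N, i < (Ξ ◇ f ◇ g ◇ k : M.N) → f ◇ i = g ◇ i) →
    (∀ i : M.N, i < k → Ψ ◇ f ◇ i = Ψ ◇ g ◇ i) ∧ N ◇ f = N ◇ g

theorem sat_UTS (Ψ : Term Γ (Ty.one ⇢ Ty.one)) : (UTS Ψ).Sat ρ ↔ IsUTS (Ψ.eval ρ) := by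
  simp only [UTS, sat_all, sat_and, sat_ex, sat_isSet, sat_infinite, sat_omits, Term.eval,
    Term.eval_wk, Env.cons, IsUTS]

theorem sat_UTSWit (Ψ : Term Γ (Ty.one ⇢ Ty.one)) (N : Term Γ Ty.two) :
    (UTSWit Ψ N).Sat ρ ↔ IsUTSWit (Ψ.eval ρ) (N.eval ρ) := by
  simp only [UTSWit, sat_all, sat_and, sat_isSet, sat_infinite, sat_omits, Term.eval,
    Term.eval_wk, Env.cons, IsUTSWit]

theorem sat_ExtFun (Ξ : Term Γ (Ty.one ⇢ Ty.one ⇢ Ty.nat ⇢ Ty.nat)) (Ψ : Term Γ (Ty.one ⇢ Ty.one))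
    (N : Term Γ Ty.two) :
    (ExtFun Ξ Ψ N).Sat ρ ↔ IsExtFun (Ξ.eval ρ) (Ψ.eval ρ) (N.eval ρ) := by
  simp only [ExtFun, sat_all, sat_imp, sat_and, sat_agree, sat_eq, Term.eval,
    Term.eval_wk, Env.cons, IsExtFun]

end

/-! ### The implications between the principles in a model, and the auxiliary functionals. -/

section

variable {M : Model}

theorem IsMu.isUTSWit {μ : M.C Ty.two} (hμ : IsMu μ) :
    IsUTSWit (thinT.eval Env.nil ◇ μ) (omittedT.eval Env.nil ◇ μ) := thin_spec hμ

theorem IsUTSWit.isUTS {Ψ : M.C (Ty.one ⇢ Ty.one)} {N : M.C Ty.two} (h : IsUTSWit Ψ N) :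
    IsUTS Ψ := fun f => ⟨(h f).1, (h f).2.1, _, (h f).2.2⟩

theorem IsUTSWit.isMu {Ψ : M.C (Ty.one ⇢ Ty.one)} {N : M.C Ty.two}
    {Ξ : M.C (Ty.one ⇢ Ty.one ⇢ Ty.nat ⇢ Ty.nat)} (h : IsUTSWit Ψ N) (hΞ : IsExtFun Ξ Ψ N) :
    IsMu (searchT.eval Env.nil ◇ Ψ ◇ N ◇ Ξ) :=
  searchT_spec (fun f => (h f).2) fun f g k h' => (hΞ f g k h').2

theorem IsUTS.exists_wit {Ψ : M.C (Ty.one ⇢ Ty.one)} (hΨ : IsUTS Ψ) :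
    ∃ (N : M.C Ty.two) (Ξ : M.C (Ty.one ⇢ Ty.one ⇢ Ty.nat ⇢ Ty.nat)),
      IsUTSWit Ψ N ∧ IsExtFun Ξ Ψ N := by
  obtain ⟨μ, hμ⟩ := exists_isMu fun f => (hΨ f).2
  let t : Term [Ty.nat, Ty.one, Ty.one ⇢ Ty.one, Ty.two] Ty.nat := tAll v3 (tAll v4
    (tImp (tLt v1 v0) (tImp (tEq (v4 ⬝ v3 ⬝ v1) numOne) (tImp (tEq (v4 ⬝ v3 ⬝ v0) numOne)
      (tNot (tEq (v3 ⬝ pairCode v1 v0) v2))))))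
  have ht (f : M.C Ty.one) (n : M.N) :
      t.eval ((((Env.nil.cons μ).cons Ψ).cons f).cons n) = (0 : M.N) ↔ Omits f (Ψ ◇ f) n := by
    simp [t, eval_tAll, hμ, Omits]
  let N : M.C Ty.two := (Term.lam (v2 ⬝ t.lam)).eval ((Env.nil.cons μ).cons Ψ)
  have hN (f : M.C Ty.one) : Omits f (Ψ ◇ f) (N ◇ f) := by
    obtain ⟨n, hn⟩ := (hΨ f).2.2
    have := hμ (t.lam.eval (((Env.nil.cons μ).cons Ψ).cons f))
      ⟨n, by rw [Term.eval_lam]; exact (ht f n).2 hn⟩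
    rw [Term.eval_lam, ht] at this
    simpa [N] using this
  -- One more than a place where `f` and `g` differ, found by `μ` if there is one. Agreement below
  -- it forces `f = g`, whatever `k` is.
  let Ξ : M.C (Ty.one ⇢ Ty.one ⇢ Ty.nat ⇢ Ty.nat) := (Term.lam (.lam (.lam (.succ ⬝
    (v3 ⬝ .lam (tNot (tEq (v3 ⬝ v0) (v2 ⬝ v0)))))))).eval (Env.nil.cons μ)
  refine ⟨N, Ξ, fun f => ⟨(hΨ f).1, (hΨ f).2.1, hN f⟩, fun f g k h => ?_⟩
  obtain rfl : f = g := by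
    refine M.ext _ _ fun j => by_contra fun hj => ?_
    have h1 := hμ ((Term.lam (tNot (tEq (v3 ⬝ v0) (v2 ⬝ v0)))).eval
      ((((Env.nil.cons μ).cons f).cons g).cons k)) ⟨j, by simpa using hj⟩
    have h2 := h (μ ◇ (Term.lam (tNot (tEq (v3 ⬝ v0) (v2 ⬝ v0)))).eval
      ((((Env.nil.cons μ).cons f).cons g).cons k)) (by simp [Ξ])
    rw [Term.eval_lam] at h1
    simp only [eval_tNot, ne_eq, eval_tEq, Term.eval, Env.cons] at h1
    exact h1 h2
  exact ⟨fun _ _ => rfl, rfl⟩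

end

end RCAomega

open RCAomega
theorem mainTheorem6 :
    -- the equivalence `(μ²) ↔ UTS(2)` in `RCA₀^ω`
    Provable (.iff MuSq UTSTwo) ∧
    -- the forward implication is explicit
    (∃ (s : Term [] (Ty.two ⇢ Ty.one ⇢ Ty.one)) (n : Term [] (Ty.two ⇢ Ty.two)),
      Provable (.all Ty.two (MU v0 ⇾ UTS (s.ofClosed ⬝ v0))) ∧
      Provable (.all Ty.two (MU v0 ⇾ UTSWit (s.ofClosed ⬝ v0) (n.ofClosed ⬝ v0)))) ∧
    -- the reverse implication is explicit (variables, in this order: `Ψ`, `N`, `Ξ`)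
    (∃ u : Term [] ((Ty.one ⇢ Ty.one) ⇢ Ty.two ⇢ (Ty.one ⇢ Ty.one ⇢ Ty.nat ⇢ Ty.nat) ⇢ Ty.two),
      Provable (.all (Ty.one ⇢ Ty.one) (.all Ty.two (.all (Ty.one ⇢ Ty.one ⇢ Ty.nat ⇢ Ty.nat)
        (UTSWit v2 v1 ⋀ ExtFun v0 v2 v1 ⇾ MU (u.ofClosed ⬝ v2 ⬝ v1 ⬝ v0)))))) ∧
    -- and its auxiliary functionals `N`, `Ξ` exist for every `Ψ` as in `UTS(2)`
    Provable (.all (Ty.one ⇢ Ty.one) (UTS v0 ⇾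
      .ex Ty.two (.ex (Ty.one ⇢ Ty.one ⇢ Ty.nat ⇢ Ty.nat) (UTSWit v2 v1 ⋀ ExtFun v0 v2 v1)))) := by
  refine ⟨provable_of_sat fun M => ?_, ⟨thinT, omittedT, provable_of_sat fun M => ?_,
    provable_of_sat fun M => ?_⟩, ⟨searchT, provable_of_sat fun M => ?_⟩,
    provable_of_sat fun M => ?_⟩
  · rw [sat_iff, MuSq, UTSTwo, sat_ex, sat_ex]
    constructor
    · rintro ⟨μ, hμ⟩
      rw [sat_MU] at hμ
      exact ⟨_, (sat_UTS _ _).2 (IsMu.isUTSWit hμ).isUTS⟩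
    · rintro ⟨Ψ, hΨ⟩
      rw [sat_UTS] at hΨ
      obtain ⟨N, Ξ, h, h'⟩ := hΨ.exists_wit
      exact ⟨_, (sat_MU _ _).2 (h.isMu h')⟩
  · intro μ hμ
    rw [sat_MU] at hμ
    rw [sat_UTS, Term.eval, Term.eval_ofClosed]
    exact (IsMu.isUTSWit hμ).isUTS
  · intro μ hμ
    rw [sat_MU] at hμ
    simp only [sat_UTSWit, Term.eval, Term.eval_ofClosed, Env.cons]
    exact IsMu.isUTSWit hμ
  · intro Ψ N Ξ h
    rw [sat_and, sat_UTSWit, sat_ExtFun] at h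
    simp only [sat_MU, Term.eval, Term.eval_ofClosed, Env.cons]
    exact h.1.isMu h.2
  · intro Ψ hΨ
    rw [sat_UTS] at hΨ
    obtain ⟨N, Ξ, h, h'⟩ := hΨ.exists_wit
    simp only [sat_ex, sat_and, sat_UTSWit, sat_ExtFun]
    exact ⟨N, Ξ, h, h'⟩
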